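/- Let $n,m\ge 1$ be integers. A cube is a cube in $\mathbb R^n$ with sides parallel to the coordinate axes and positive side length, and $\frac1{|Q|}\int_Q$ denotes the average over $Q$ with respect to Lebesgue measure. A weight is a measurable function on $\mathbb R^n$ with values in $(0,\infty)$ almost everywhere. Let $\vec w=(w_1,\dots,w_m)$ be an $m$-tuple of weights, put $\nu=\prod_{i=1}^m w_i^{1/m}$, and suppose that $\vec w\in A_{\vec 1}$, i.e. $$\sup_Q\Big(\frac1{|Q|}\int_Q\nu\Big)^{m}\prod_{i=1}^m\big(\operatorname*{ess\,inf}_Q w_i\big)^{-1}<\infty .$$ Let $v$ be a weight such that $\nu v^{1/m}\in A_\infty=\bigcup_{1<p<\infty}A_p$, where a weight $u$ is in $A_p$ if $\sup_Q\big(\frac1{|Q|}\int_Q u\big)\big(\frac1{|Q|}\int_Q u^{-1/(p-1)}\big)^{p-1}<\infty$ (all suprema are over all cubes $Q$). Then there is a finite constant $C$ such that for all measurable functions $f_1,\dots,f_m:\mathbb R^n\to\mathbb C$, $$\Big\|\frac{\mathcal M(\vec f\,)}{v}\Big\|_{L^{1/m,\infty}(\nu v^{1/m})}\le C\prod_{i=1}^m\|f_i\|_{L^1(w_i)},$$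 where $$\mathcal M(\vec f\,)(x)=\sup_{Q\ni x}\prod_{i=1}^m\frac1{|Q|}\int_Q|f_i(y)|\,dy,\qquad \|f_i\|_{L^1(w_i)}=\int_{\mathbb R^n}|f_i|\,w_i\,dx,$$ $$\|g\|_{L^{1/m,\infty}(\nu v^{1/m})}=\sup_{t>0}\,t\,\Big(\int_{\{x:\,|g(x)|>t\}}\nu(x)\,v(x)^{1/m}\,dx\Big)^{m},$$ and $0\cdot\infty=0$ in products. -/

import Mathlib

open MeasureTheory Filter
open scoped ENNReal NNReal

noncomputable section

namespace MixedWeak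

/-- The closed cube in `ℝⁿ` with sides parallel to the axes, lower corner `a` and side length `l`
(it is a genuine cube when `0 < l`). -/
def cube {n : ℕ} (a : Fin n → ℝ) (l : ℝ) : Set (Fin n → ℝ) :=
  Set.Icc a (fun j => a j + l)

/-- The average `(1 / |Q|) ∫_Q g` of a function with values in `[0, ∞]` over the cube
`Q = cube a l`, with respect to Lebesgue measure. -/
def avg {n : ℕ} (a : Fin n → ℝ) (l : ℝ) (g : (Fin n → ℝ) → ℝ≥0∞) : ℝ≥0∞ :=
  (volume (cube a l))⁻¹ * ∫⁻ x in cube a l, g x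

/-- A weight on `ℝⁿ`: a Lebesgue measurable function with values in `[0, ∞]` such that
`0 < w < ∞` almost everywhere. Local integrability is not part of the definition: it is implied
by each scalar Muckenhoupt condition, but the components of a vector weight
satisfying the multilinear `A_1` condition need not be locally integrable. -/
structure IsWeight {n : ℕ} (w : (Fin n → ℝ) → ℝ≥0∞) : Prop where
  aemeasurable : AEMeasurable w volume
  pos : ∀ᵐ x ∂(volume : Measure (Fin n → ℝ)), 0 < w x
  lt_top : ∀ᵐ x ∂(volume : Measure (Fin n → ℝ)), w x < ∞

/-- The Muckenhoupt class `A_p` for `1 < p < ∞` (note `1 - p' = -1 / (p - 1)`):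
the supremum over all cubes `Q` of `(⨍_Q w) (⨍_Q w^{1 - p'})^{p - 1}` is finite. -/
def MemAp {n : ℕ} (p : ℝ) (w : (Fin n → ℝ) → ℝ≥0∞) : Prop :=
  IsWeight w ∧ ∃ C : ℝ≥0, ∀ (a : Fin n → ℝ) (l : ℝ), 0 < l →
    avg a l w * avg a l (fun x => w x ^ (-1 / (p - 1))) ^ (p - 1) ≤ C

/-- The class `A_∞`, the union of the classes `A_p`, `1 < p < ∞`. -/
def MemAInfty {n : ℕ} (w : (Fin n → ℝ) → ℝ≥0∞) : Prop :=
  ∃ p : ℝ, 1 < p ∧ MemAp p w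

/-- `ν = w₁^{1/m} ⋯ w_m^{1/m}`. -/
def nu {n m : ℕ} (w : Fin m → (Fin n → ℝ) → ℝ≥0∞) (x : Fin n → ℝ) : ℝ≥0∞ :=
  ∏ i, w i x ^ (1 / (m : ℝ))

/-- The multilinear condition `A_{(1, …, 1)}`: the `w_i` are weights, and the supremum over all
cubes `Q` of `(⨍_Q ν)^m ∏_i (ess inf_Q w_i)⁻¹` is finite. -/
def MemAOneVec {n m : ℕ} (w : Fin m → (Fin n → ℝ) → ℝ≥0∞) : Prop :=
  (∀ i, IsWeight (w i)) ∧ ∃ C : ℝ≥0, ∀ (a : Fin n → ℝ) (l : ℝ), 0 < l →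
    avg a l (nu w) ^ m *
      ∏ i, (essInf (w i) (volume.restrict (cube a l)))⁻¹ ≤ C

/-- The multi(sub)linear maximal function
`𝓜(f₁, …, f_m)(x) = sup_{Q ∋ x} ∏_i (1 / |Q|) ∫_Q |f_i|`, the supremum being over all cubes `Q`
containing `x`. -/
def multiMaximal {n m : ℕ} (f : Fin m → (Fin n → ℝ) → ℂ) (x : Fin n → ℝ) : ℝ≥0∞ :=
  ⨆ (a : Fin n → ℝ) (l : ℝ) (_ : 0 < l) (_ : x ∈ cube a l),
    ∏ i, avg a l (fun y => ‖f i y‖ₑ)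

/-- The weak Lebesgue (quasi)norm `‖g‖_{L^{p,∞}(μ)} = sup_{t > 0} t μ({g > t})^{1/p}` of a
function with values in `[0, ∞]`. -/
def weakNorm {X : Type*} [MeasurableSpace X] (p : ℝ) (μ : Measure X) (g : X → ℝ≥0∞) : ℝ≥0∞ :=
  ⨆ (t : ℝ≥0) (_ : 0 < t), (t : ℝ≥0∞) * μ {x | (t : ℝ≥0∞) < g x} ^ (1 / p)

end MixedWeak

end

/-! Write `u` for `ν` and `r` for `ν v^{1/m}`, so that `(u/r)^m = 1/v` almost everywhere. On each
cube the vector condition trades the product of the averages of `|f_i|` for the product of the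
quotients `u(Q)⁻¹ ∫_Q |f_i| w_i` (`prod_avg_le`). Cubes of bounded size are captured by `2^n` dyadic
grids (`exists_cube_subset_dCube`), so `𝓜(f)/v` is controlled by products of `m` linear dyadic
operators `(u/r) sup_Q u(Q)⁻¹ ∫_Q |f_i| w_i`. A weak type Hölder inequality
(`mul_measure_pow_le_of_prod`) then leaves the weak `(1,1)` bound for one such operator with respect
to `r dx`.

For that bound put `μ = r dx` and `W = u/r`. The only input is a reverse Hölder inequality for `W`
relative to `μ` (`exists_reverse_holder`): the vector condition makes `u` an `A_1` weight, which
gives reverse Hölder with respect to Lebesgue measure (`reverse_holder_of_le_essInf`), and Hölder's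
inequality combines this with `r ∈ A_q` for an exponent `p > 1`.

The core is `mixed_weak_type_of_reverse_holder`. The set where the `μ`-maximal function of `g`
exceeds `t` is handled by the weak `(1,1)` bound. At any other point of a cube `Q`, the `μ`-average
of `g` over `Q` is at most `t`, hence it is at most `H = min(M_μ g, t)` throughout `Q`. With `κ =
W^p μ`, the reverse Hölder inequality bounds the `(p-1)`-st power of the `Wμ`-normalized average by
the `κ`-maximal function of `F = H^{p-1} W^{1-p}`. Chebyshev, the boundedness of `M_κ` on
`L^{p'}(κ)` and `∫ F^{p'} dκ = ∫ H^p dμ ≲ t^{p-1} ∫ g dμ` finish. Dyadic cubes are nested, so none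
of these maximal bounds needs doubling. -/

noncomputable section

namespace MixedWeak

/-! ### Maximal functions over nested families -/

section NestedMaximal

variable {X ι : Type*}

/-- A family of sets any two members of which are disjoint or comparable. -/
def Nested (Q : ι → Set X) : Prop :=
  ∀ i j, Disjoint (Q i) (Q j) ∨ Q i ⊆ Q j ∨ Q j ⊆ Q i

/-- Only the maximal members matter: a new set is either absorbed by a chosen one, or it swallows
every chosen set that it meets. This replaces a covering lemma with no loss of constant. -/
theorem Nested.exists_disjoint_subfamily {Q : ι → Set X} (hQ : Nested Q) (S : Finset ι) :
    ∃ T ⊆ S, (T : Set ι).PairwiseDisjoint Q ∧ ⋃ i ∈ T, Q i = ⋃ i ∈ S, Q i := by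
  classical
  induction S using Finset.induction_on with
  | empty => exact ⟨∅, by simp, by simp, by simp⟩
  | insert q S _ ih =>
    obtain ⟨T, hTS, hd, hU⟩ := ih
    by_cases h : ∃ i ∈ T, Q q ⊆ Q i
    · obtain ⟨i, hi, hqi⟩ := h
      refine ⟨T, hTS.trans (Finset.subset_insert _ _), hd, ?_⟩
      rw [Finset.set_biUnion_insert, ← hU, Set.union_eq_right.2]
      exact hqi.trans (Set.subset_biUnion_of_mem (u := Q) hi)
    · push Not at h
      refine ⟨insert q (T.filter fun i => Disjoint (Q q) (Q i)),
        Finset.insert_subset_insert _ ((Finset.filter_subset _ _).trans hTS), ?_, ?_⟩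
      · rw [Finset.coe_insert]
        refine Set.PairwiseDisjoint.insert (hd.subset fun i hi => (Finset.mem_filter.1 hi).1)
          fun i hi _ => ?_
        exact (Finset.mem_filter.1 hi).2
      · rw [Finset.set_biUnion_insert, Finset.set_biUnion_insert, ← hU]
        refine subset_antisymm (Set.union_subset_union_right _
          (Set.biUnion_subset_biUnion_left (Finset.filter_subset _ _))) ?_
        refine Set.union_subset Set.subset_union_left (Set.iUnion₂_subset fun i hi => ?_)
        by_cases hdi : Disjoint (Q q) (Q i)
        · exact (Set.subset_biUnion_of_mem (u := Q)
            (Finset.mem_filter.2 ⟨hi, hdi⟩)).trans Set.subset_union_right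
        · rcases hQ q i with h1 | h1 | h1
          · exact absurd h1 hdi
          · exact absurd h1 (h i hi)
          · exact h1.trans Set.subset_union_left

variable [MeasurableSpace X]

/-- The maximal function over the sets of a family, with respect to the measure `μ`. -/
def famMaximal (Q : ι → Set X) (μ : Measure X) (g : X → ℝ≥0∞) (x : X) : ℝ≥0∞ :=
  ⨆ i, (Q i).indicator (fun _ => (μ (Q i))⁻¹ * ∫⁻ y in Q i, g y ∂μ) x

variable {Q : ι → Set X} {μ : Measure X}

theorem lt_famMaximal_iff {g : X → ℝ≥0∞} {s : ℝ≥0∞} {x : X} :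
    s < famMaximal Q μ g x ↔ ∃ i, x ∈ Q i ∧ s < (μ (Q i))⁻¹ * ∫⁻ y in Q i, g y ∂μ := by
  rw [famMaximal, lt_iSup_iff]
  refine exists_congr fun i => ?_
  by_cases hx : x ∈ Q i <;> simp [hx]

theorem average_le_famMaximal (g : X → ℝ≥0∞) {x : X} {i : ι} (hx : x ∈ Q i) :
    (μ (Q i))⁻¹ * ∫⁻ y in Q i, g y ∂μ ≤ famMaximal Q μ g x := by
  refine le_iSup_of_le i ?_
  rw [Set.indicator_of_mem hx]

theorem measurable_famMaximal [Countable ι] (hm : ∀ i, MeasurableSet (Q i)) (g : X → ℝ≥0∞) :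
    Measurable (famMaximal Q μ g) :=
  Measurable.iSup fun i => measurable_const.indicator (hm i)

theorem mul_measure_biUnion_le (hQ : Nested Q) (hm : ∀ i, MeasurableSet (Q i)) {g : X → ℝ≥0∞}
    {s : ℝ≥0∞} (S : Finset ι) (hS : ∀ i ∈ S, s < (μ (Q i))⁻¹ * ∫⁻ y in Q i, g y ∂μ) :
    s * μ (⋃ i ∈ S, Q i) ≤ ∫⁻ y, g y ∂μ := by
  obtain ⟨T, hTS, hd, hU⟩ := hQ.exists_disjoint_subfamily S
  rw [← hU, measure_biUnion_finset hd fun i _ => hm i, Finset.mul_sum]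
  calc ∑ i ∈ T, s * μ (Q i) ≤ ∑ i ∈ T, ∫⁻ y in Q i, g y ∂μ := by
        refine Finset.sum_le_sum fun i hi => ENNReal.mul_le_of_le_div ?_
        rw [ENNReal.div_eq_inv_mul]
        exact (hS i (hTS hi)).le
    _ = ∫⁻ y in ⋃ i ∈ T, Q i, g y ∂μ := (lintegral_biUnion_finset hd (fun i _ => hm i) g).symm
    _ ≤ ∫⁻ y, g y ∂μ := setLIntegral_le_lintegral _ _

/-- The weak type `(1, 1)` bound for the maximal function of a countable nested family. -/
theorem mul_measure_lt_famMaximal_le [Countable ι] (hQ : Nested Q) (hm : ∀ i, MeasurableSet (Q i))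
    (g : X → ℝ≥0∞) (s : ℝ≥0∞) :
    s * μ {x | s < famMaximal Q μ g x} ≤ ∫⁻ y, g y ∂μ := by
  classical
  set I : Set ι := {i | s < (μ (Q i))⁻¹ * ∫⁻ y in Q i, g y ∂μ} with hI
  have hset : {x | s < famMaximal Q μ g x} =
      ⋃ S : Finset I, ⋃ i ∈ S.map (Function.Embedding.subtype _), Q i := by
    ext x
    simp only [Set.mem_ofPred_eq, lt_famMaximal_iff, Set.mem_iUnion]
    constructor
    · rintro ⟨i, hx, hi⟩
      exact ⟨{⟨i, hi⟩}, i, by simp, hx⟩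
    · rintro ⟨S, i, hi, hx⟩
      obtain ⟨j, _, rfl⟩ := Finset.mem_map.1 hi
      exact ⟨j, hx, j.2⟩
  -- The level set is a directed union of finite unions, so the finite bound passes to the supremum.
  have hdir : Directed (· ⊆ ·) fun S : Finset I =>
      ⋃ i ∈ S.map (Function.Embedding.subtype _), Q i := by
    refine Monotone.directed_le fun S T hST => ?_
    exact Set.biUnion_subset_biUnion_left fun i hi => Finset.map_subset_map.2 hST hi
  rw [hset, hdir.measure_iUnion, ENNReal.mul_iSup]
  refine iSup_le fun S => mul_measure_biUnion_le hQ hm _ fun i hi => ?_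
  obtain ⟨j, _, rfl⟩ := Finset.mem_map.1 hi
  exact j.2

/-- Averages of a constant are at most that constant (they may be smaller when a set has measure
zero or infinity). This permits cutting `g` at a height before applying the weak type bound. -/
theorem famMaximal_le_add (g h : X → ℝ≥0∞) {c : ℝ≥0∞}
    (hg : ∀ x, g x ≤ h x + c) (x : X) : famMaximal Q μ g x ≤ famMaximal Q μ h x + c := by
  refine iSup_le fun i => ?_
  by_cases hx : x ∈ Q i
  · rw [Set.indicator_of_mem hx]
    refine le_trans ?_ (add_le_add_left (average_le_famMaximal h hx) c)
    calc (μ (Q i))⁻¹ * ∫⁻ y in Q i, g y ∂μ ≤ (μ (Q i))⁻¹ * ∫⁻ y in Q i, (h y + c) ∂μ := by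
          gcongr with y; exact hg y
      _ = (μ (Q i))⁻¹ * (∫⁻ y in Q i, h y ∂μ) + ((μ (Q i))⁻¹ * μ (Q i)) * c := by
          rw [lintegral_add_right _ measurable_const, setLIntegral_const, mul_add]; ring
      _ ≤ _ := by
          gcongr
          calc _ ≤ 1 * c := by gcongr; exact ENNReal.inv_mul_le_one _
            _ = c := one_mul c
  · simp [hx]

/-! ### Layer cake formula for functions with values in `[0, ∞]` -/

theorem lintegral_Ioo_rpow {r b : ℝ} (hr : 0 < r) (hb : 0 ≤ b) :
    ∫⁻ s in Set.Ioo 0 b, ENNReal.ofReal (s ^ (r - 1)) =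
      ENNReal.ofReal b ^ r / ENNReal.ofReal r := by
  have hint : IntervalIntegrable (fun s : ℝ => s ^ (r - 1)) volume 0 b :=
    intervalIntegral.intervalIntegrable_rpow' (by linarith)
  rw [restrict_Ioo_eq_restrict_Ioc, ← ofReal_integral_eq_lintegral_ofReal,
    ← intervalIntegral.integral_of_le hb, integral_rpow (Or.inl (by linarith)),
    ENNReal.ofReal_rpow_of_nonneg hb hr.le, ← ENNReal.ofReal_div_of_pos hr]
  · simp [Real.zero_rpow hr.ne']
  · exact (intervalIntegrable_iff_integrableOn_Ioc_of_le hb).1 hint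
  · filter_upwards [ae_restrict_mem measurableSet_Ioc] with s hs
    exact Real.rpow_nonneg hs.1.le _

theorem lintegral_Ioi_rpow_indicator {r : ℝ} (hr : 0 < r) (a : ℝ≥0∞) :
    ∫⁻ s in Set.Ioi (0 : ℝ), {s : ℝ | ENNReal.ofReal s < a}.indicator
      (fun s => ENNReal.ofReal (s ^ (r - 1))) s = a ^ r / ENNReal.ofReal r := by
  have key : ∀ b : ℝ, 0 ≤ b → ∫⁻ s in Set.Ioi (0 : ℝ), (Set.Iio b).indicator
      (fun s => ENNReal.ofReal (s ^ (r - 1))) s = ENNReal.ofReal b ^ r / ENNReal.ofReal r := by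
    intro b hb
    rw [lintegral_indicator measurableSet_Iio, Measure.restrict_restrict measurableSet_Iio,
      Set.inter_comm, Set.Ioi_inter_Iio, lintegral_Ioo_rpow hr hb]
  rcases eq_or_ne a ∞ with rfl | ha
  · rw [ENNReal.top_rpow_of_pos hr, ENNReal.top_div_of_ne_top ENNReal.ofReal_ne_top]
    refine ENNReal.eq_top_of_forall_nnreal_le fun c => ?_
    have h1 := key (((c : ℝ) * r) ^ (1 / r)) (by positivity)
    rw [ENNReal.ofReal_rpow_of_nonneg (by positivity) hr.le, ← Real.rpow_mul (by positivity),
      one_div_mul_cancel hr.ne', Real.rpow_one, ← ENNReal.ofReal_div_of_pos hr,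
      mul_div_cancel_right₀ _ hr.ne', ENNReal.ofReal_coe_nnreal] at h1
    rw [← h1]
    refine lintegral_mono fun s => Set.indicator_le_indicator_of_subset (fun s _ => ?_)
      (fun _ => zero_le) s
    simp
  · rw [← ENNReal.ofReal_toReal ha, ← key _ ENNReal.toReal_nonneg]
    refine setLIntegral_congr_fun measurableSet_Ioi fun s hs => ?_
    have h2 : s ∈ {s : ℝ | ENNReal.ofReal s < ENNReal.ofReal a.toReal} ↔ s ∈ Set.Iio a.toReal :=
      ENNReal.ofReal_lt_ofReal_iff_of_nonneg (le_of_lt hs)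
    by_cases h : s ∈ Set.Iio a.toReal
    · rw [Set.indicator_of_mem h, Set.indicator_of_mem (h2.2 h)]
    · rw [Set.indicator_of_notMem h, Set.indicator_of_notMem (fun h' => h (h2.1 h'))]

theorem lintegral_rpow_eq_lintegral_measure [SFinite μ] {f : X → ℝ≥0∞} (hf : Measurable f) {r : ℝ}
    (hr : 0 < r) :
    (∫⁻ x, f x ^ r ∂μ) / ENNReal.ofReal r =
      ∫⁻ s in Set.Ioi (0 : ℝ), ENNReal.ofReal (s ^ (r - 1)) * μ {x | ENNReal.ofReal s < f x} := by
  have hmeas : Measurable (Function.uncurry fun (x : X) (s : ℝ) =>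
      {s : ℝ | ENNReal.ofReal s < f x}.indicator (fun s => ENNReal.ofReal (s ^ (r - 1))) s) := by
    have : (Function.uncurry fun (x : X) (s : ℝ) =>
      {s : ℝ | ENNReal.ofReal s < f x}.indicator (fun s => ENNReal.ofReal (s ^ (r - 1))) s) =
      {p : X × ℝ | ENNReal.ofReal p.2 < f p.1}.indicator
        (fun p => ENNReal.ofReal (p.2 ^ (r - 1))) := by
      ext ⟨x, s⟩
      by_cases h : ENNReal.ofReal s < f x
      · rw [Set.indicator_of_mem (by exact h), Function.uncurry_apply_pair,
          Set.indicator_of_mem (by exact h)]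
      · rw [Set.indicator_of_notMem (by exact h), Function.uncurry_apply_pair,
          Set.indicator_of_notMem (by exact h)]
    rw [this]
    exact (by fun_prop : Measurable fun p : X × ℝ => ENNReal.ofReal (p.2 ^ (r - 1))).indicator
      (measurableSet_lt (by fun_prop) (by fun_prop))
  have h1 : (∫⁻ x, f x ^ r ∂μ) / ENNReal.ofReal r = ∫⁻ x, (∫⁻ s in Set.Ioi (0 : ℝ),
      {s : ℝ | ENNReal.ofReal s < f x}.indicator (fun s => ENNReal.ofReal (s ^ (r - 1))) s) ∂μ := by
    simp_rw [lintegral_Ioi_rpow_indicator hr, div_eq_mul_inv]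
    rw [lintegral_mul_const _ (by fun_prop)]
  rw [h1, lintegral_lintegral_swap hmeas.aemeasurable]
  refine lintegral_congr fun s => ?_
  have h2 : ∀ x, {s : ℝ | ENNReal.ofReal s < f x}.indicator
      (fun s => ENNReal.ofReal (s ^ (r - 1))) s =
      {x | ENNReal.ofReal s < f x}.indicator (fun _ => ENNReal.ofReal (s ^ (r - 1))) x := by
    intro x
    by_cases h : ENNReal.ofReal s < f x <;> simp [h]
  simp_rw [h2]
  rw [lintegral_indicator_const (measurableSet_lt measurable_const hf)]

/-! ### Integral bounds deduced from the weak type estimate -/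

/-- The bound for the maximal function on `L^q`, `1 < q`. -/
theorem lintegral_famMaximal_rpow_le [Countable ι] [SFinite μ] (hQ : Nested Q)
    (hm : ∀ i, MeasurableSet (Q i)) {g : X → ℝ≥0∞} (hg : Measurable g) {q : ℝ} (hq : 1 < q) :
    ∫⁻ x, famMaximal Q μ g x ^ q ∂μ ≤
      ENNReal.ofReal (q * 2 ^ q / (q - 1)) * ∫⁻ x, g x ^ q ∂μ := by
  have hq0 : 0 < q := by linarith
  have hq1 : 0 < q - 1 := by linarith
  -- Marcinkiewicz truncation: the part of `g` below `s / 2` raises the maximal function by at most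
  -- `s / 2`, so only the part where `2 * g > s` is charged. Writing it as a measure with density
  -- `g` lets the layer cake formula be reused with exponent `q - 1`.
  have hweak : ∀ s : ℝ, 0 < s →
      ENNReal.ofReal (s / 2) * μ {x | ENNReal.ofReal s < famMaximal Q μ g x} ≤
      μ.withDensity g {x | ENNReal.ofReal s < 2 * g x} := by
    intro s hs
    have hms : MeasurableSet {x | ENNReal.ofReal s < 2 * g x} :=
      measurableSet_lt measurable_const (by fun_prop)
    have hs2 : ENNReal.ofReal s = ENNReal.ofReal (s / 2) + ENNReal.ofReal (s / 2) := by
      rw [← ENNReal.ofReal_add (by positivity) (by positivity)]; ring_nf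
    set h := {x | ENNReal.ofReal s < 2 * g x}.indicator g
    rw [withDensity_apply _ hms, ← lintegral_indicator hms]
    refine le_trans ?_ (mul_measure_lt_famMaximal_le hQ hm h (ENNReal.ofReal (s / 2)))
    refine mul_le_mul_right (measure_mono fun x hx => ?_) _
    have hgh : ∀ x, g x ≤ h x + ENNReal.ofReal (s / 2) := by
      intro x
      by_cases hx : ENNReal.ofReal s < 2 * g x
      · simp [h, hx]
      · refine le_add_left ?_
        rw [not_lt, hs2, ← two_mul] at hx
        exact (ENNReal.mul_le_mul_iff_right two_ne_zero ENNReal.ofNat_ne_top).1 hx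
    have h3 := lt_of_lt_of_le (Set.mem_ofPred_eq ▸ hx) (famMaximal_le_add g h hgh x)
    rw [hs2] at h3
    exact lt_of_add_lt_add_right h3
  have hA := lintegral_rpow_eq_lintegral_measure (μ := μ)
    (measurable_famMaximal (μ := μ) hm g) hq0
  have hB := lintegral_rpow_eq_lintegral_measure (μ := μ.withDensity g) (f := fun x => 2 * g x)
    (by fun_prop) hq1
  have hC : ∫⁻ x, (2 * g x) ^ (q - 1) ∂(μ.withDensity g) = 2 ^ (q - 1) * ∫⁻ x, g x ^ q ∂μ := by
    rw [lintegral_withDensity_eq_lintegral_mul _ hg (by fun_prop),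
      ← lintegral_const_mul _ (by fun_prop)]
    refine lintegral_congr fun x => ?_
    rw [Pi.mul_apply, ENNReal.mul_rpow_of_nonneg _ _ hq1.le, mul_left_comm]
    congr 1
    nth_rewrite 1 [← ENNReal.rpow_one (g x)]
    rw [← ENNReal.rpow_add_of_nonneg _ _ zero_le_one hq1.le]
    congr 1; ring
  have hD : (∫⁻ x, famMaximal Q μ g x ^ q ∂μ) / ENNReal.ofReal q ≤
      2 * (2 ^ (q - 1) * (∫⁻ x, g x ^ q ∂μ) / ENNReal.ofReal (q - 1)) := by
    rw [hA, ← hC, hB, ← lintegral_const_mul' _ _ ENNReal.ofNat_ne_top]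
    refine setLIntegral_mono' measurableSet_Ioi fun s hs => ?_
    have hs : 0 < s := hs
    calc ENNReal.ofReal (s ^ (q - 1)) * μ {x | ENNReal.ofReal s < famMaximal Q μ g x}
        = 2 * (ENNReal.ofReal (s ^ (q - 1 - 1)) * (ENNReal.ofReal (s / 2) *
            μ {x | ENNReal.ofReal s < famMaximal Q μ g x})) := by
          have : (s ^ (q - 1)) = 2 * (s ^ (q - 1 - 1) * (s / 2)) := by
            rw [Real.rpow_sub_one hs.ne' (q - 1)]; field_simp
          rw [this, ENNReal.ofReal_mul zero_le_two, ENNReal.ofReal_mul (by positivity)]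
          simp only [ENNReal.ofReal_ofNat]
          ring
      _ ≤ _ := by gcongr; exact hweak s hs
  have hq' : ENNReal.ofReal q ≠ 0 := by simpa using hq0
  rw [ENNReal.div_le_iff hq' ENNReal.ofReal_ne_top] at hD
  refine hD.trans (le_of_eq ?_)
  have h2 : (2 : ℝ≥0∞) ^ (q - 1) = ENNReal.ofReal (2 ^ (q - 1)) := by
    rw [← ENNReal.ofReal_rpow_of_pos two_pos]; simp
  have h3 : q * 2 ^ q / (q - 1) = 2 * (2 ^ (q - 1) * q) * (q - 1)⁻¹ := by
    rw [Real.rpow_sub_one two_ne_zero]; field_simp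
  rw [h3, ENNReal.ofReal_mul (by positivity), ENNReal.ofReal_mul zero_le_two,
    ENNReal.ofReal_mul (by positivity), ENNReal.ofReal_inv_of_pos hq1, h2, div_eq_mul_inv]
  simp only [ENNReal.ofReal_ofNat]
  ring

/-- A truncated bound for the maximal function on `L^p`, `1 < p`, in terms of the `L^1` norm. -/
theorem lintegral_min_famMaximal_rpow_le [Countable ι] [SFinite μ] (hQ : Nested Q)
    (hm : ∀ i, MeasurableSet (Q i)) (g : X → ℝ≥0∞) {p : ℝ} (hp : 1 < p) (t : ℝ≥0∞) :
    ∫⁻ x, min (famMaximal Q μ g x) t ^ p ∂μ ≤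
      ENNReal.ofReal (p / (p - 1)) * t ^ (p - 1) * ∫⁻ x, g x ∂μ := by
  have hp0 : 0 < p := by linarith
  have hp1 : 0 < p - 1 := by linarith
  have hA := lintegral_rpow_eq_lintegral_measure (μ := μ)
    (f := fun x => min (famMaximal Q μ g x) t)
    ((measurable_famMaximal (μ := μ) hm g).min measurable_const) hp0
  have hD : (∫⁻ x, min (famMaximal Q μ g x) t ^ p ∂μ) / ENNReal.ofReal p ≤
      t ^ (p - 1) / ENNReal.ofReal (p - 1) * ∫⁻ x, g x ∂μ := by
    -- Levels `s ≥ t` contribute nothing. Below `t` the weak type bound turns `s^(p-1)` into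
    -- `s^(p-2)`, integrable at `0` because `p > 1`.
    rw [hA, ← lintegral_Ioi_rpow_indicator hp1, ← lintegral_mul_const]
    · refine setLIntegral_mono' measurableSet_Ioi fun s hs => ?_
      have hs : 0 < s := hs
      by_cases hst : ENNReal.ofReal s < t
      · rw [Set.indicator_of_mem (by exact hst), Real.rpow_sub_one hs.ne' (p - 1), div_eq_mul_inv,
          ENNReal.ofReal_mul (by positivity), mul_assoc]
        gcongr
        rw [ENNReal.ofReal_inv_of_pos hs, ← ENNReal.div_eq_inv_mul, ENNReal.le_div_iff_mul_le
          (Or.inl (by simpa using hs)) (Or.inl ENNReal.ofReal_ne_top), mul_comm]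
        refine le_trans ?_ (mul_measure_lt_famMaximal_le hQ hm g (ENNReal.ofReal s))
        refine mul_le_mul_right (measure_mono fun x h => ?_) _
        simp only [Set.mem_ofPred_eq, lt_min_iff] at h ⊢
        exact h.1
      · have : {x | ENNReal.ofReal s < min (famMaximal Q μ g x) t} = ∅ := by
          ext x; simp [hst]
        rw [this, measure_empty, mul_zero]
        exact zero_le
    · exact (by fun_prop : Measurable fun s : ℝ => ENNReal.ofReal (s ^ (p - 1 - 1))).indicator
        (measurableSet_lt (by fun_prop) (by fun_prop))
  have hp' : ENNReal.ofReal p ≠ 0 := by simpa using hp0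
  rw [ENNReal.div_le_iff hp' ENNReal.ofReal_ne_top] at hD
  refine hD.trans (le_of_eq ?_)
  rw [ENNReal.ofReal_div_of_pos hp1, div_eq_mul_inv, div_eq_mul_inv]
  ring

end NestedMaximal

/-! ### The linear mixed weak type inequality -/

section MixedWeakType

variable {X ι : Type*} [MeasurableSpace X] {Q : ι → Set X} {μ : Measure X}

/-- Reverse Hölder as it is used on one cube: `m`, `N`, `k` stand for the integrals of `1`, `W`,
`W^p`, and `a` for the average of `g`. The right side is a `W^p`-average of `a^(p-1) W^(1-p)`. -/
theorem rpow_average_div_le {p : ℝ} (hp : 1 < p) {C m N k a : ℝ≥0∞} (hN0 : N ≠ 0) (hN : N ≠ ∞)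
    (hk0 : k ≠ 0) (hk : k ≠ ∞) (h : k * m ^ (p - 1) ≤ C * N ^ p) :
    (N⁻¹ * (m * a)) ^ (p - 1) ≤ C * (k⁻¹ * (a ^ (p - 1) * N)) := by
  have hp1 : 0 ≤ p - 1 := by linarith
  rw [ENNReal.mul_rpow_of_nonneg _ _ hp1, ENNReal.mul_rpow_of_nonneg _ _ hp1, ENNReal.inv_rpow]
  have h1 : m ^ (p - 1) ≤ k⁻¹ * (C * N ^ p) := by
    rw [← ENNReal.div_eq_inv_mul, ENNReal.le_div_iff_mul_le (Or.inl hk0) (Or.inl hk), mul_comm]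
    exact h
  have h2 : N ^ p = N ^ (p - 1) * N := by
    nth_rewrite 3 [← ENNReal.rpow_one N]
    rw [← ENNReal.rpow_add _ _ hN0 hN]
    congr 1; ring
  have h3 : (N ^ (p - 1))⁻¹ * N ^ (p - 1) = 1 :=
    ENNReal.inv_mul_cancel (by simp [hN0, hN]) (by simp [hN0, hN])
  calc (N ^ (p - 1))⁻¹ * (m ^ (p - 1) * a ^ (p - 1))
      ≤ (N ^ (p - 1))⁻¹ * (k⁻¹ * (C * N ^ p) * a ^ (p - 1)) := by gcongr
    _ = ((N ^ (p - 1))⁻¹ * N ^ (p - 1)) * (C * (k⁻¹ * (a ^ (p - 1) * N))) := by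
        rw [h2]; ring
    _ = _ := by rw [h3, one_mul]

/-- The mixed weak type inequality for the maximal function of a nested family with respect to
the measure `ν = W μ`, when `W` satisfies a reverse Hölder inequality with respect to `μ`. -/
theorem mixed_weak_type_of_reverse_holder [Countable ι] [SFinite μ] (hQ : Nested Q)
    (hm : ∀ i, MeasurableSet (Q i)) {W : X → ℝ≥0∞} (hW : Measurable W) (hW0 : ∀ x, W x ≠ 0)
    (hWt : ∀ x, W x ≠ ∞) {p : ℝ} (hp : 1 < p) {C : ℝ≥0∞} (hC : C ≠ ∞) (hμ0 : ∀ i, μ (Q i) ≠ 0)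
    (hμt : ∀ i, μ (Q i) ≠ ∞) (hνt : ∀ i, ∫⁻ x in Q i, W x ∂μ ≠ ∞)
    (hRH : ∀ i, (∫⁻ x in Q i, W x ^ p ∂μ) * μ (Q i) ^ (p - 1) ≤ C * (∫⁻ x in Q i, W x ∂μ) ^ p)
    (g : X → ℝ≥0∞) {t : ℝ≥0∞} (ht0 : t ≠ 0) (ht : t ≠ ∞) :
    t * μ {x | ∃ i, x ∈ Q i ∧ t < W x * ((∫⁻ y in Q i, W y ∂μ)⁻¹ * ∫⁻ y in Q i, g y ∂μ)} ≤
      (1 + C ^ (p / (p - 1)) * ENNReal.ofReal (p / (p - 1) * 2 ^ (p / (p - 1)) /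
        (p / (p - 1) - 1)) * ENNReal.ofReal (p / (p - 1))) * ∫⁻ x, g x ∂μ := by
  have hp0 : 0 < p := by linarith
  have hp1 : 0 < p - 1 := by linarith
  set q := p / (p - 1) with hq
  have hq1 : 1 < q := by rw [hq, lt_div_iff₀ hp1]; linarith
  have hq0 : 0 < q := by linarith
  set κ := μ.withDensity (fun x => W x ^ p) with hκ
  have hWp : Measurable fun x => W x ^ p := by fun_prop
  set H : X → ℝ≥0∞ := fun x => min (famMaximal Q μ g x) t with hH
  have hHm : Measurable H := (measurable_famMaximal hm g).min measurable_const
  -- The power of `W` is chosen so that, against `κ`, `F` has density `H^(p-1) W` and `F^q` has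
  -- density `H^p`, with `q` conjugate to `p`. `F` is measurable even if `g` is not, since the
  -- maximal function always is.
  set F : X → ℝ≥0∞ := fun x => H x ^ (p - 1) * W x ^ (1 - p) with hF
  have hFm : Measurable F := by fun_prop
  have hN0 : ∀ i, ∫⁻ x in Q i, W x ∂μ ≠ 0 := fun i h => by
    rw [lintegral_eq_zero_iff hW] at h
    apply hμ0 i
    rw [← Measure.restrict_eq_zero, ← ae_eq_bot, ← Filter.eventually_false_iff_eq_bot]
    filter_upwards [h] with x hx using hW0 x hx
  have hk0 : ∀ i, ∫⁻ x in Q i, W x ^ p ∂μ ≠ 0 := fun i h => by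
    rw [lintegral_eq_zero_iff hWp] at h
    apply hμ0 i
    rw [← Measure.restrict_eq_zero, ← ae_eq_bot, ← Filter.eventually_false_iff_eq_bot]
    filter_upwards [h] with x hx
    simp [hW0 x, hWt x] at hx
  have hkt : ∀ i, ∫⁻ x in Q i, W x ^ p ∂μ ≠ ∞ := fun i h => by
    have h1 := hRH i
    rw [h, ENNReal.top_mul (by simp [hμ0 i, hμt i]), top_le_iff] at h1
    exact ENNReal.mul_ne_top hC (ENNReal.rpow_ne_top_of_nonneg hp0.le (hνt i)) h1
  have hFW : ∀ x, W x ^ p * F x = H x ^ (p - 1) * W x := fun x => by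
    rw [hF, mul_left_comm, ← ENNReal.rpow_add _ _ (hW0 x) (hWt x)]
    simp
  have hFq : ∀ x, W x ^ p * F x ^ q = H x ^ p := fun x => by
    rw [hF, ENNReal.mul_rpow_of_nonneg _ _ hq0.le, ← ENNReal.rpow_mul, ← ENNReal.rpow_mul,
      mul_left_comm, ← ENNReal.rpow_add _ _ (hW0 x) (hWt x)]
    have e1 : (p - 1) * q = p := by rw [hq]; field_simp
    have e2 : p + (1 - p) * q = 0 := by linarith
    rw [e1, e2, ENNReal.rpow_zero, mul_one]
  -- The average `a` over `Q i` is bounded by the maximal function at every point of `Q i`, and by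
  -- `t` because of the single point `x`; hence `a ≤ H` on all of `Q i`.
  have hpt : ∀ i, ∀ x ∈ Q i, ¬ t < famMaximal Q μ g x →
      ((∫⁻ y in Q i, W y ∂μ)⁻¹ * ∫⁻ y in Q i, g y ∂μ) ^ (p - 1) ≤ C * famMaximal Q κ F x := by
    intro i x hx hxt
    set a := (μ (Q i))⁻¹ * ∫⁻ y in Q i, g y ∂μ with ha
    have hat : a ≤ t := (average_le_famMaximal g hx).trans (not_lt.1 hxt)
    have hma : ∫⁻ y in Q i, g y ∂μ = μ (Q i) * a := by
      rw [ha, ← mul_assoc, ENNReal.mul_inv_cancel (hμ0 i) (hμt i), one_mul]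
    rw [hma]
    refine (rpow_average_div_le hp (hN0 i) (hνt i) (hk0 i) (hkt i) (hRH i)).trans ?_
    gcongr
    refine le_trans ?_ (average_le_famMaximal F hx)
    rw [hκ, withDensity_apply _ (hm i),
      setLIntegral_withDensity_eq_setLIntegral_mul _ hWp hFm (hm i),
      ← lintegral_const_mul _ hW]
    refine mul_le_mul' le_rfl ?_
    refine setLIntegral_mono' (hm i) fun y hy => ?_
    rw [Pi.mul_apply, hFW]
    gcongr
    exact le_min (average_le_famMaximal g hy) hat
  set B : Set X := {x | t ^ p ≤ C ^ q * (W x ^ p * famMaximal Q κ F x ^ q)} with hB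
  have hsub : {x | ∃ i, x ∈ Q i ∧ t < W x * ((∫⁻ y in Q i, W y ∂μ)⁻¹ * ∫⁻ y in Q i, g y ∂μ)} ⊆
      {x | t < famMaximal Q μ g x} ∪ B := by
    rintro x ⟨i, hx, hti⟩
    by_cases hxt : t < famMaximal Q μ g x
    · exact Or.inl hxt
    · refine Or.inr ?_
      have h1 := ENNReal.rpow_le_rpow (hpt i x hx hxt) hq0.le
      have e1 : (p - 1) * q = p := by rw [hq]; field_simp
      rw [← ENNReal.rpow_mul, e1, ENNReal.mul_rpow_of_nonneg _ _ hq0.le] at h1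
      calc t ^ p ≤ (W x * ((∫⁻ y in Q i, W y ∂μ)⁻¹ * ∫⁻ y in Q i, g y ∂μ)) ^ p := by
            gcongr
        _ ≤ W x ^ p * (C ^ q * famMaximal Q κ F x ^ q) := by
            rw [ENNReal.mul_rpow_of_nonneg _ _ hp0.le]; gcongr
        _ = _ := by ring
  have hMm := measurable_famMaximal (μ := κ) hm F
  have hBle : t ^ p * μ B ≤ C ^ q * (ENNReal.ofReal (q * 2 ^ q / (q - 1)) *
      (ENNReal.ofReal q * t ^ (p - 1) * ∫⁻ x, g x ∂μ)) := by
    refine (mul_meas_ge_le_lintegral₀ (by fun_prop) _).trans ?_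
    rw [lintegral_const_mul _ (by fun_prop)]
    gcongr
    calc ∫⁻ x, W x ^ p * famMaximal Q κ F x ^ q ∂μ = ∫⁻ x, famMaximal Q κ F x ^ q ∂κ := by
          rw [hκ, lintegral_withDensity_eq_lintegral_mul _ hWp (by fun_prop)]; rfl
      _ ≤ ENNReal.ofReal (q * 2 ^ q / (q - 1)) * ∫⁻ x, F x ^ q ∂κ :=
          lintegral_famMaximal_rpow_le hQ hm hFm hq1
      _ = ENNReal.ofReal (q * 2 ^ q / (q - 1)) * ∫⁻ x, H x ^ p ∂μ := by
          rw [hκ, lintegral_withDensity_eq_lintegral_mul _ hWp (by fun_prop)]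
          simp_rw [Pi.mul_apply, hFq]
      _ ≤ _ := by
          gcongr
          exact lintegral_min_famMaximal_rpow_le hQ hm g hp t
  have htp : t ^ p = t * t ^ (p - 1) := by
    nth_rewrite 2 [← ENNReal.rpow_one t]
    rw [← ENNReal.rpow_add _ _ ht0 ht]
    congr 1; ring
  have hBle' : t * μ B ≤ C ^ q * ENNReal.ofReal (q * 2 ^ q / (q - 1)) * ENNReal.ofReal q *
      ∫⁻ x, g x ∂μ := by
    have ht1 : t ^ (p - 1) ≠ 0 := by simp [ht0, ht]
    have ht2 : t ^ (p - 1) ≠ ∞ := by simp [ht0, ht]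
    rw [← ENNReal.mul_le_mul_iff_right ht1 ht2]
    calc t ^ (p - 1) * (t * μ B) = t ^ p * μ B := by rw [htp]; ring
      _ ≤ _ := hBle
      _ = _ := by ring
  calc _ ≤ t * (μ {x | t < famMaximal Q μ g x} + μ B) := by
        gcongr
        exact (measure_mono hsub).trans (measure_union_le _ _)
    _ ≤ _ := by
        rw [mul_add, add_mul, one_mul]
        exact add_le_add (mul_measure_lt_famMaximal_le hQ hm g t) hBle'

end MixedWeakType

/-! ### Dyadic grids and the one-third trick -/

section Dyadic

variable {n : ℕ}

/-- The half-open dyadic cube of side length `2 ^ (-k)` with index `z` in the dyadic grid with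
origin `o`. -/
def dCube (o : Fin n → ℝ) (k : ℤ) (z : Fin n → ℤ) : Set (Fin n → ℝ) :=
  {y | ∀ j, ⌊(y j - o j) * 2 ^ k⌋ = z j}

/-- The lower corner of `dCube o k z`. -/
def dCorner (o : Fin n → ℝ) (k : ℤ) (z : Fin n → ℤ) (j : Fin n) : ℝ :=
  o j + z j * (2 ^ k)⁻¹

theorem mem_dCube {o : Fin n → ℝ} {k : ℤ} {z : Fin n → ℤ} {y : Fin n → ℝ} :
    y ∈ dCube o k z ↔ ∀ j, ⌊(y j - o j) * 2 ^ k⌋ = z j := Iff.rfl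

theorem dCube_eq_pi (o : Fin n → ℝ) (k : ℤ) (z : Fin n → ℤ) :
    dCube o k z =
      Set.univ.pi fun j => Set.Ico (dCorner o k z j) (dCorner o k z j + (2 ^ k)⁻¹) := by
  ext y
  simp only [mem_dCube, Set.mem_univ_pi, Set.mem_Ico, dCorner]
  refine forall_congr' fun j => ?_
  have h2 : (0 : ℝ) < 2 ^ k := by positivity
  rw [Int.floor_eq_iff, ← div_le_iff₀ h2, ← lt_div_iff₀ h2, div_eq_mul_inv, div_eq_mul_inv]
  constructor <;> rintro ⟨h, h'⟩ <;> constructor <;> linarith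

theorem measurableSet_dCube (o : Fin n → ℝ) (k : ℤ) (z : Fin n → ℤ) :
    MeasurableSet (dCube o k z) := by
  rw [dCube_eq_pi]
  exact MeasurableSet.univ_pi fun j => measurableSet_Ico

theorem dCube_ae_eq_cube (o : Fin n → ℝ) (k : ℤ) (z : Fin n → ℤ) :
    dCube o k z =ᵐ[volume] cube (dCorner o k z) (2 ^ k)⁻¹ := by
  rw [dCube_eq_pi]
  exact Measure.univ_pi_Ico_ae_eq_Icc

theorem dCube_subset_cube (o : Fin n → ℝ) (k : ℤ) (z : Fin n → ℤ) :
    dCube o k z ⊆ cube (dCorner o k z) (2 ^ k)⁻¹ := by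
  rw [dCube_eq_pi, cube, ← Set.pi_univ_Icc]
  exact Set.pi_mono fun j _ => Set.Ico_subset_Icc_self

theorem volume_cube (a : Fin n → ℝ) (l : ℝ) : volume (cube a l) = ENNReal.ofReal l ^ n := by
  simp [cube, Real.volume_Icc_pi]

theorem volume_dCube (o : Fin n → ℝ) (k : ℤ) (z : Fin n → ℤ) :
    volume (dCube o k z) = ENNReal.ofReal (2 ^ k)⁻¹ ^ n := by
  rw [measure_congr (dCube_ae_eq_cube o k z), volume_cube]

theorem volume_dCube_ne_zero (o : Fin n → ℝ) (k : ℤ) (z : Fin n → ℤ) :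
    volume (dCube o k z) ≠ 0 := by
  rw [volume_dCube]
  exact pow_ne_zero _ (by simp; positivity)

theorem volume_dCube_ne_top (o : Fin n → ℝ) (k : ℤ) (z : Fin n → ℤ) :
    volume (dCube o k z) ≠ ∞ := by
  rw [volume_dCube]
  exact ENNReal.pow_ne_top ENNReal.ofReal_ne_top

theorem restrict_dCube (o : Fin n → ℝ) (k : ℤ) (z : Fin n → ℤ) :
    volume.restrict (dCube o k z) = volume.restrict (cube (dCorner o k z) (2 ^ k)⁻¹) :=
  Measure.restrict_congr_set (dCube_ae_eq_cube o k z)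

theorem avg_dCorner (o : Fin n → ℝ) (k : ℤ) (z : Fin n → ℤ) (g : (Fin n → ℝ) → ℝ≥0∞) :
    avg (dCorner o k z) (2 ^ k)⁻¹ g = (volume (dCube o k z))⁻¹ * ∫⁻ x in dCube o k z, g x := by
  rw [avg, restrict_dCube, measure_congr (dCube_ae_eq_cube o k z)]

theorem floor_mul_two_zpow (s : ℝ) (k : ℤ) (d : ℕ) :
    ⌊s * 2 ^ k⌋ = ⌊s * 2 ^ (k + d)⌋ / (2 ^ d : ℕ) := by
  rw [← Int.floor_div_natCast]
  congr 1
  rw [zpow_add₀ two_ne_zero]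
  push_cast
  rw [zpow_natCast]
  field_simp

theorem nested_dCube (o : Fin n → ℝ) :
    Nested fun i : ℤ × (Fin n → ℤ) => dCube o i.1 i.2 := by
  have key : ∀ (k k' : ℤ) (z z' : Fin n → ℤ), k ≤ k' → ¬ Disjoint (dCube o k z) (dCube o k' z') →
      dCube o k' z' ⊆ dCube o k z := by
    intro k k' z z' hk hd
    obtain ⟨x, hx, hx'⟩ := Set.not_disjoint_iff.1 hd
    obtain ⟨d, rfl⟩ := Int.le.dest hk
    intro y hy
    rw [mem_dCube] at *
    intro j
    rw [← hx j, floor_mul_two_zpow, floor_mul_two_zpow (x j - o j), hy j, hx' j]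
  rintro ⟨k, z⟩ ⟨k', z'⟩
  by_cases hd : Disjoint (dCube o k z) (dCube o k' z')
  · exact Or.inl hd
  · rcases le_total k k' with h | h
    · exact Or.inr (Or.inr (key _ _ _ _ h hd))
    · exact Or.inr (Or.inl (key _ _ _ _ h fun h => hd h.symm))

theorem dCube_eq_iUnion_children (o : Fin n → ℝ) (k : ℤ) (z : Fin n → ℤ) :
    dCube o k z = ⋃ z' : {z' : Fin n → ℤ // ∀ j, z' j / 2 = z j}, dCube o (k + 1) z' := by
  ext y
  have h : ∀ j, ⌊(y j - o j) * 2 ^ k⌋ = ⌊(y j - o j) * 2 ^ (k + 1)⌋ / 2 := fun j => by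
    simpa using floor_mul_two_zpow (y j - o j) k 1
  simp only [Set.mem_iUnion, mem_dCube, h]
  constructor
  · exact fun hy => ⟨⟨fun j => ⌊(y j - o j) * 2 ^ (k + 1)⌋, hy⟩, fun j => rfl⟩
  · rintro ⟨⟨z', hz'⟩, hy⟩ j
    rw [hy j, hz' j]

theorem pairwise_disjoint_dCube (o : Fin n → ℝ) (k : ℤ) :
    Pairwise (Function.onFun Disjoint fun z => dCube o k z) := by
  intro z z' hz
  refine Set.disjoint_left.2 fun y hy hy' => hz ?_
  ext j
  rw [← hy j, hy' j]

theorem setLIntegral_dCube_eq_tsum (o : Fin n → ℝ) (k : ℤ) (z : Fin n → ℤ)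
    (g : (Fin n → ℝ) → ℝ≥0∞) :
    ∫⁻ x in dCube o k z, g x =
      ∑' z' : {z' : Fin n → ℤ // ∀ j, z' j / 2 = z j}, ∫⁻ x in dCube o (k + 1) z', g x := by
  rw [dCube_eq_iUnion_children, lintegral_iUnion (fun _ => measurableSet_dCube _ _ _)]
  exact fun z₁ z₂ h => pairwise_disjoint_dCube o (k + 1) fun h' => h (Subtype.ext h')

/-- The origins of finitely many dyadic grids which together capture every cube of
side length at most `2 ^ K / 6`. -/
def gridOrigin (K : ℕ) (c : Fin n → Bool) (j : Fin n) : ℝ :=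
  if c j then 2 ^ K / 3 else 0

/-- If both grids had a point in the short interval, the integers `i`, `j` below would satisfy `|3
(i - j) - 2^N| < 1`, forcing `3 ∣ 2^N`. -/
theorem floor_eq_or_floor_shift_eq {b h : ℝ} (hh : 3 * h < 1) (h0 : 0 ≤ h) (N : ℕ) :
    ⌊b⌋ = ⌊b + h⌋ ∨ ⌊b - 2 ^ N / 3⌋ = ⌊b + h - 2 ^ N / 3⌋ := by
  by_contra! hne
  have h1 : ⌊b⌋ < ⌊b + h⌋ := lt_of_le_of_ne (Int.floor_mono (by linarith)) hne.1
  have h2 : ⌊b - 2 ^ N / 3⌋ < ⌊b + h - 2 ^ N / 3⌋ :=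
    lt_of_le_of_ne (Int.floor_mono (by linarith)) hne.2
  have h1' := Int.floor_lt.1 h1
  have h2' := Int.floor_lt.1 h2
  have h3 := Int.floor_le (b + h)
  have h4 := Int.floor_le (b + h - 2 ^ N / 3)
  set i := ⌊b + h⌋
  set j := ⌊b + h - 2 ^ N / 3⌋
  have h5 : (-1 : ℝ) < ((3 * (i - j) - 2 ^ N : ℤ) : ℝ) := by push_cast; linarith
  have h6 : ((3 * (i - j) - 2 ^ N : ℤ) : ℝ) < 1 := by push_cast; linarith
  have h5' : -1 < 3 * (i - j) - (2 : ℤ) ^ N := by exact_mod_cast h5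
  have h6' : 3 * (i - j) - (2 : ℤ) ^ N < 1 := by exact_mod_cast h6
  have h7 : (3 : ℤ) ∣ 2 ^ N := ⟨i - j, by omega⟩
  have h8 := Int.Prime.dvd_pow' Nat.prime_three h7
  omega

theorem exists_cube_subset_dCube {K : ℕ} (a : Fin n → ℝ) {l : ℝ} (hl : 0 < l)
    (hlK : 6 * l ≤ 2 ^ K) :
    ∃ c k z, cube a l ⊆ dCube (gridOrigin K c) k z ∧ ((2 : ℝ) ^ k)⁻¹ ≤ 6 * l := by
  -- The dyadic side length is `2^(e+1)`, which lies in `(3l, 6l]`. The bound `6l ≤ 2^K` makes the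
  -- shift `2^K / 3` equal to `2^N / 3` with `N ≥ 0` at this scale.
  obtain ⟨e, he, he'⟩ := exists_mem_Ico_zpow (x := 3 * l) (y := (2 : ℝ)) (by positivity) one_lt_two
  have heq : (2 : ℝ) ^ (e + 1) = 2 * 2 ^ e := by rw [zpow_add₀ two_ne_zero]; ring
  have heK : e + 1 ≤ K := by
    have : (2 : ℝ) ^ (e + 1) ≤ 2 ^ (K : ℤ) := by rw [zpow_natCast]; linarith
    exact (zpow_le_zpow_iff_right₀ one_lt_two).1 this
  obtain ⟨N, hN⟩ := Int.le.dest heK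
  have h2 : (0 : ℝ) < 2 ^ (-(e + 1)) := by positivity
  have hpow : (2 : ℝ) ^ K * 2 ^ (-(e + 1)) = 2 ^ N := by
    rw [← zpow_natCast, ← zpow_natCast, ← zpow_add₀ two_ne_zero]; congr 1; omega
  have hl3 : 3 * (l * 2 ^ (-(e + 1))) < 1 := by
    rw [zpow_neg, ← mul_assoc, ← div_eq_mul_inv, div_lt_one (by positivity)]; exact he'
  have hex : ∀ j, ∃ b : Bool, ⌊(a j - if b then 2 ^ K / 3 else 0) * 2 ^ (-(e + 1))⌋ =
      ⌊(a j + l - if b then 2 ^ K / 3 else 0) * 2 ^ (-(e + 1))⌋ := by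
    intro j
    rcases floor_eq_or_floor_shift_eq (b := a j * 2 ^ (-(e + 1))) hl3 (by positivity) N with h | h
    · refine ⟨false, ?_⟩
      simpa [add_mul] using h
    · refine ⟨true, ?_⟩
      rw [← hpow] at h
      simp only [if_true]
      convert h using 2 <;> ring
  choose c hc using hex
  refine ⟨c, -(e + 1), fun j => ⌊(a j - gridOrigin K c j) * 2 ^ (-(e + 1))⌋, fun y hy j => ?_, ?_⟩
  · have hy1 : a j ≤ y j := hy.1 j
    have hy2 : y j ≤ a j + l := hy.2 j
    refine le_antisymm ?_ (Int.floor_mono (by gcongr))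
    simp only [gridOrigin]
    rw [hc j]
    exact Int.floor_mono (by gcongr)
  · rw [zpow_neg, inv_inv, heq]; linarith

theorem avg_le_of_cube_subset_dCube {a : Fin n → ℝ} {l : ℝ} (hl : 0 < l) {o : Fin n → ℝ} {k : ℤ}
    {z : Fin n → ℤ} (hsub : cube a l ⊆ dCube o k z) (hkl : ((2 : ℝ) ^ k)⁻¹ ≤ 6 * l)
    (g : (Fin n → ℝ) → ℝ≥0∞) :
    avg a l g ≤ 6 ^ n * avg (dCorner o k z) (2 ^ k)⁻¹ g := by
  rw [avg_dCorner, avg, ← mul_assoc]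
  gcongr
  rw [volume_dCube, volume_cube, ENNReal.inv_pow, ENNReal.inv_pow, ← mul_pow]
  gcongr
  rw [← div_eq_mul_inv]
  have h0 : ENNReal.ofReal (2 ^ k)⁻¹ ≠ 0 := by simp; positivity
  rw [ENNReal.le_div_iff_mul_le (Or.inl h0) (Or.inl ENNReal.ofReal_ne_top), mul_comm,
    ENNReal.mul_inv_le_iff (by simpa using hl) ENNReal.ofReal_ne_top]
  rw [show (6 : ℝ≥0∞) = ENNReal.ofReal 6 by simp, ← ENNReal.ofReal_mul (by norm_num)]
  exact ENNReal.ofReal_le_ofReal hkl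

end Dyadic

/-! ### Reverse Hölder inequality for `A_1` weights -/

section ReverseHolder

/-- The function `2 x m^ε - m^(1+ε)` decreases in `m` as long as `x ≤ K m` and `2 K ε ≤ 1`; the
proof uses Bernoulli's inequality. It serves as a Bellman function, and the inequality is arranged
without subtraction for use in `ℝ≥0∞`. -/
theorem two_mul_mul_rpow_add_le {x m m' K ε : ℝ} (hm : 0 < m) (hmm : m ≤ m') (hx : 0 ≤ x)
    (hxK : x ≤ K * m) (hε : 0 ≤ ε) (hε1 : ε ≤ 1) (hKε : 2 * (K * ε) ≤ 1) :
    2 * x * m' ^ ε + m ^ (1 + ε) ≤ 2 * x * m ^ ε + m' ^ (1 + ε) := by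
  have hm' : 0 < m' := hm.trans_le hmm
  have hmε : 0 ≤ m ^ ε := by positivity
  have hB : (m' / m) ^ ε ≤ 1 + ε * (m' / m - 1) := by
    have := rpow_one_add_le_one_add_mul_self (s := m' / m - 1) (p := ε)
      (by have := div_pos hm' hm; linarith) hε hε1
    simpa using this
  rw [Real.div_rpow hm'.le hm.le, div_le_iff₀ (by positivity)] at hB
  have h2 : m * (m' / m - 1) = m' - m := by field_simp
  have h3 : m ^ (1 + ε) = m * m ^ ε := by rw [Real.rpow_add hm, Real.rpow_one]
  have h4 : m' ^ (1 + ε) = m' * m' ^ ε := by rw [Real.rpow_add hm', Real.rpow_one]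
  have h5 : m ^ ε ≤ m' ^ ε := Real.rpow_le_rpow hm.le hmm hε
  have h6 : 0 ≤ m' / m - 1 := by rw [sub_nonneg, le_div_iff₀ hm]; linarith
  have h7 : 2 * x * (m' ^ ε - m ^ ε) ≤ m ^ ε * (m' - m) := by
    calc 2 * x * (m' ^ ε - m ^ ε) ≤ 2 * x * (ε * (m' / m - 1) * m ^ ε) := by
          gcongr; linarith
      _ ≤ 2 * (K * m) * (ε * (m' / m - 1) * m ^ ε) := by gcongr
      _ = 2 * (K * ε) * (m ^ ε * (m * (m' / m - 1))) := by ring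
      _ = 2 * (K * ε) * (m ^ ε * (m' - m)) := by rw [h2]
      _ ≤ 1 * (m ^ ε * (m' - m)) :=
          mul_le_mul_of_nonneg_right hKε (mul_nonneg hmε (by linarith))
      _ = _ := one_mul _
  rw [h3, h4]
  nlinarith [mul_le_mul_of_nonneg_left h5 hm'.le]

theorem ennreal_two_mul_mul_rpow_add_le {x m m' : ℝ≥0∞} {K ε : ℝ} (hmm : m ≤ m') (hm' : m' ≠ ∞)
    (hxK : x ≤ ENNReal.ofReal K * m) (hK : 0 ≤ K) (hε : 0 < ε) (hε1 : ε ≤ 1)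
    (hKε : 2 * (K * ε) ≤ 1) :
    2 * x * m' ^ ε + m ^ (1 + ε) ≤ 2 * x * m ^ ε + m' ^ (1 + ε) := by
  have hm : m ≠ ∞ := ne_top_of_le_ne_top hm' hmm
  have hε2 : 0 < 1 + ε := by linarith
  rcases eq_or_ne m 0 with rfl | hm0
  · have : x = 0 := by simpa using hxK
    simp [this, hε2]
  have hx : x ≠ ∞ := ne_top_of_le_ne_top (ENNReal.mul_ne_top ENNReal.ofReal_ne_top hm) hxK
  lift m to ℝ≥0 using hm
  lift m' to ℝ≥0 using hm'
  lift x to ℝ≥0 using hx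
  have hm0' : m ≠ 0 := by simpa using hm0
  lift K to ℝ≥0 using hK
  rw [ENNReal.ofReal_coe_nnreal] at hxK
  rw [← ENNReal.coe_rpow_of_nonneg _ hε.le, ← ENNReal.coe_rpow_of_nonneg _ hε.le,
    ← ENNReal.coe_rpow_of_nonneg _ hε2.le, ← ENNReal.coe_rpow_of_nonneg _ hε2.le]
  norm_cast at hxK hmm ⊢
  rw [← NNReal.coe_le_coe] at hxK hmm ⊢
  push_cast at hxK ⊢
  exact two_mul_mul_rpow_add_le (by positivity) hmm x.2 hxK hε.le hε1 hKε

variable {n : ℕ}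

/-- The index of the dyadic cube of generation `k` containing `y`. -/
def dIndex (o : Fin n → ℝ) (k : ℤ) (y : Fin n → ℝ) (j : Fin n) : ℤ :=
  ⌊(y j - o j) * 2 ^ k⌋

theorem mem_dCube_dIndex (o : Fin n → ℝ) (k : ℤ) (y : Fin n → ℝ) :
    y ∈ dCube o k (dIndex o k y) := fun _ => rfl

theorem dIndex_eq {o : Fin n → ℝ} {k : ℤ} {z : Fin n → ℤ} {y : Fin n → ℝ}
    (hy : y ∈ dCube o k z) : dIndex o k y = z := funext hy

/-- The conditional expectation of `u` on the dyadic grid of generation `k`. -/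
def dExpect (o : Fin n → ℝ) (u : (Fin n → ℝ) → ℝ≥0∞) (k : ℤ) (y : Fin n → ℝ) : ℝ≥0∞ :=
  (volume (dCube o k (dIndex o k y)))⁻¹ * ∫⁻ x in dCube o k (dIndex o k y), u x

theorem measurable_dExpect (o : Fin n → ℝ) (u : (Fin n → ℝ) → ℝ≥0∞) (k : ℤ) :
    Measurable (dExpect o u k) := by
  have h : Measurable (dIndex o k) := by
    refine measurable_pi_lambda _ fun j => Measurable.floor ?_
    fun_prop
  exact (measurable_of_countable fun z : Fin n → ℤ =>
    (volume (dCube o k z))⁻¹ * ∫⁻ x in dCube o k z, u x).comp h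

theorem cube_eq_closedBall (a : Fin n → ℝ) {l : ℝ} (hl : 0 ≤ l) :
    cube a l = Metric.closedBall (fun j => a j + l / 2) (l / 2) := by
  rw [closedBall_pi _ (by positivity), cube, ← Set.pi_univ_Icc]
  congr 1
  ext1 j
  rw [Real.closedBall_eq_Icc]
  congr 1 <;> ring

theorem dCube_subset_of_mem {o : Fin n → ℝ} {k : ℤ} {z : Fin n → ℤ} {y : Fin n → ℝ}
    (hy : y ∈ dCube o k z) (N : ℕ) : dCube o (k + N) (dIndex o (k + N) y) ⊆ dCube o k z := by
  intro x hx j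
  rw [← hy j, floor_mul_two_zpow _ k N, floor_mul_two_zpow (y j - o j) k N, hx j]
  rfl

/-- In the sup norm a cube is a ball. The point need not be its centre, which the Vitali family of
the doubling measure tolerates. Restricting `u` to one fixed cube supplies the finite integral
required by Lebesgue differentiation. -/
theorem ae_tendsto_dExpect (o : Fin n → ℝ) (k : ℤ) (z : Fin n → ℤ) {u : (Fin n → ℝ) → ℝ≥0∞}
    (hu : Measurable u) (hfin : ∫⁻ x in dCube o k z, u x ≠ ∞) :
    ∀ᵐ y, y ∈ dCube o k z →
      Tendsto (fun N : ℕ => dExpect o u (k + N) y) atTop (nhds (u y)) := by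
  set f := (dCube o k z).indicator u with hf
  have hfm : Measurable f := hu.indicator (measurableSet_dCube o k z)
  have hfin' : ∫⁻ x, f x ≠ ∞ := by rwa [hf, lintegral_indicator (measurableSet_dCube o k z)]
  filter_upwards [VitaliFamily.ae_tendsto_lintegral_div
    (IsUnifLocDoublingMeasure.vitaliFamily (volume : Measure (Fin n → ℝ)) 1)
    hfm.aemeasurable hfin'] with y hy hyQ
  have hl : ∀ N : ℕ, (0 : ℝ) < (2 ^ (k + N))⁻¹ := fun N => by positivity
  have hδ : Tendsto (fun N : ℕ => ((2 : ℝ) ^ (k + N))⁻¹ / 2) atTop (nhdsWithin 0 (Set.Ioi 0)) := by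
    refine tendsto_nhdsWithin_iff.2 ⟨?_, Eventually.of_forall fun N => by
      have := hl N; simp only [Set.mem_Ioi]; positivity⟩
    have h1 : Tendsto (fun N : ℕ => ((2 : ℝ) ^ k)⁻¹ / 2 * (1 / 2) ^ N) atTop (nhds 0) := by
      have := (tendsto_pow_atTop_nhds_zero_of_lt_one (r := (1 / 2 : ℝ)) (by norm_num)
        (by norm_num)).const_mul (((2 : ℝ) ^ k)⁻¹ / 2)
      simpa using this
    refine h1.congr fun N => ?_
    rw [zpow_add₀ two_ne_zero, zpow_natCast]
    simp only [one_div, inv_pow, mul_inv]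
    ring
  have hmem : ∀ N : ℕ, y ∈ Metric.closedBall
      (fun j => dCorner o (k + N) (dIndex o (k + N) y) j + ((2 : ℝ) ^ (k + N))⁻¹ / 2)
      (1 * (((2 : ℝ) ^ (k + N))⁻¹ / 2)) := fun N => by
    rw [one_mul, ← cube_eq_closedBall _ (hl N).le]
    exact dCube_subset_cube _ _ _ (mem_dCube_dIndex o _ y)
  have hfy : f y = u y := Set.indicator_of_mem hyQ u
  rw [← hfy]
  refine ((hy.comp (IsUnifLocDoublingMeasure.tendsto_closedBall_filterAt volume _ _ hδ
    (Eventually.of_forall hmem)))).congr fun N => ?_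
  simp only [Function.comp]
  rw [← cube_eq_closedBall _ (hl N).le, ← restrict_dCube,
    ← measure_congr (dCube_ae_eq_cube o _ _), dExpect, ENNReal.div_eq_inv_mul]
  congr 1
  refine setLIntegral_congr_fun (measurableSet_dCube _ _ _) fun x hx => ?_
  exact Set.indicator_of_mem (dCube_subset_of_mem hyQ N hx) u

theorem volume_dCube_child (o : Fin n → ℝ) (k : ℤ) (z z' : Fin n → ℤ) :
    volume (dCube o k z) = 2 ^ n * volume (dCube o (k + 1) z') := by
  rw [volume_dCube, volume_dCube, ← mul_pow, ← ENNReal.ofReal_ofNat 2,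
    ← ENNReal.ofReal_mul zero_le_two, zpow_add₀ two_ne_zero]
  congr 2
  simp

/-- Bellman induction on the number of generations. The extra term on the left makes the bound
additive over children: passing from a cube to its children can only raise the essential infimum,
and the Bellman function decreases in it. -/
theorem lintegral_dExpect_rpow_add_le {o : Fin n → ℝ} {u : (Fin n → ℝ) → ℝ≥0∞}
    {C : ℝ≥0} (hfin : ∀ k z, ∫⁻ x in dCube o k z, u x ≠ ∞)
    (hC : ∀ k z, (volume (dCube o k z))⁻¹ * ∫⁻ x in dCube o k z, u x ≤
      C * essInf u (volume.restrict (dCube o k z))) {ε : ℝ} (hε : 0 < ε) (hε1 : ε ≤ 1)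
    (hCε : 2 * (2 ^ n * C * ε) ≤ 1) (N : ℕ) (k : ℤ) (z : Fin n → ℤ) :
    (∫⁻ x in dCube o k z, dExpect o u (k + N) x ^ (1 + ε)) +
      C ^ ε * (essInf u (volume.restrict (dCube o k z)) ^ (1 + ε) * volume (dCube o k z)) ≤
    C ^ ε * (2 * essInf u (volume.restrict (dCube o k z)) ^ ε * ∫⁻ x in dCube o k z, u x) := by
  have hε2 : 0 < 1 + ε := by linarith
  have hadd : ∀ s : ℝ≥0∞, s ^ (1 + ε) = s * s ^ ε := fun s => by
    rw [ENNReal.rpow_add_of_nonneg _ _ zero_le_one hε.le, ENNReal.rpow_one]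
  have hint : ∀ k z, ∫⁻ x in dCube o k z, u x =
      ((volume (dCube o k z))⁻¹ * ∫⁻ x in dCube o k z, u x) * volume (dCube o k z) := by
    intro k z
    rw [mul_right_comm, ENNReal.inv_mul_cancel (volume_dCube_ne_zero o k z)
      (volume_dCube_ne_top o k z), one_mul]
  have hmle : ∀ k z, essInf u (volume.restrict (dCube o k z)) ≤
      (volume (dCube o k z))⁻¹ * ∫⁻ x in dCube o k z, u x := by
    intro k z
    rw [← ENNReal.div_eq_inv_mul, ENNReal.le_div_iff_mul_le
      (Or.inl (volume_dCube_ne_zero o k z)) (Or.inl (volume_dCube_ne_top o k z)),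
      ← setLIntegral_const]
    exact lintegral_mono_ae ae_essInf_le
  induction N generalizing k z with
  | zero =>
    set V := volume (dCube o k z) with hV
    set m := essInf u (volume.restrict (dCube o k z)) with hm
    set x := V⁻¹ * ∫⁻ x in dCube o k z, u x with hx
    have hE : ∫⁻ y in dCube o k z, dExpect o u (k + (0 : ℕ)) y ^ (1 + ε) = x ^ (1 + ε) * V := by
      rw [hV, ← setLIntegral_const]
      refine setLIntegral_congr_fun (measurableSet_dCube _ _ _) fun y hy => ?_
      simp only [Nat.cast_zero, add_zero, dExpect]
      rw [dIndex_eq hy]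
    rw [hE, hint k z, ← hV, ← hx, hadd, hadd]
    have h1 : x ^ ε ≤ C ^ ε * m ^ ε := by
      rw [← ENNReal.mul_rpow_of_nonneg _ _ hε.le]
      exact ENNReal.rpow_le_rpow (hC k z) hε.le
    calc x * x ^ ε * V + C ^ ε * (m * m ^ ε * V)
        ≤ x * (C ^ ε * m ^ ε) * V + C ^ ε * (x * m ^ ε * V) := by
          gcongr
          exact hmle k z
      _ = _ := by ring
  | succ N ih =>
    have hvol : volume (dCube o k z) =
        ∑' z' : {z' : Fin n → ℤ // ∀ j, z' j / 2 = z j}, volume (dCube o (k + 1) z') := by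
      have := setLIntegral_dCube_eq_tsum o k z 1
      simpa using this
    rw [setLIntegral_dCube_eq_tsum o k z, hvol]
    rw [setLIntegral_dCube_eq_tsum o k z (fun x => u x)]
    simp_rw [← ENNReal.tsum_mul_left]
    rw [← ENNReal.tsum_add]
    refine ENNReal.tsum_le_tsum fun z' => ?_
    have hsub : dCube o (k + 1) z' ⊆ dCube o k z := by
      rw [dCube_eq_iUnion_children o k z]
      exact Set.subset_iUnion (fun z' : {z' : Fin n → ℤ // ∀ j, z' j / 2 = z j} =>
        dCube o (k + 1) z') z'
    have hk : k + ((N + 1 : ℕ) : ℤ) = k + 1 + N := by push_cast; ring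
    rw [hk]
    have h1 := ih (k + 1) z'
    have hmm : essInf u (volume.restrict (dCube o k z)) ≤
        essInf u (volume.restrict (dCube o (k + 1) z')) :=
      essInf_antitone_measure (Measure.restrict_mono_set _ hsub).absolutelyContinuous
    -- The child's average is compared with the infimum over the parent, at the cost of the volume
    -- ratio `2^n`.
    have hxK : (volume (dCube o (k + 1) z'))⁻¹ * ∫⁻ x in dCube o (k + 1) z', u x ≤
        ENNReal.ofReal (2 ^ n * C) * essInf u (volume.restrict (dCube o k z)) := by
      calc (volume (dCube o (k + 1) z'))⁻¹ * ∫⁻ x in dCube o (k + 1) z', u x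
          ≤ (2 ^ n * (volume (dCube o k z))⁻¹) * ∫⁻ x in dCube o k z, u x := by
            refine mul_le_mul' (le_of_eq ?_) (lintegral_mono_set hsub)
            rw [volume_dCube_child o k z z', ENNReal.mul_inv (by simp) (by simp), ← mul_assoc,
              ENNReal.mul_inv_cancel (by simp) (by simp), one_mul]
        _ ≤ 2 ^ n * (C * essInf u (volume.restrict (dCube o k z))) := by
            rw [mul_assoc]; exact mul_le_mul' le_rfl (hC k z)
        _ = _ := by
            rw [ENNReal.ofReal_mul (by positivity), ENNReal.ofReal_pow zero_le_two]
            simp only [ENNReal.ofReal_ofNat, ENNReal.ofReal_coe_nnreal]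
            ring
    have hm't : essInf u (volume.restrict (dCube o (k + 1) z')) ≠ ∞ :=
      ne_top_of_le_ne_top (ENNReal.mul_ne_top (ENNReal.inv_ne_top.2 (volume_dCube_ne_zero o _ _))
        (hfin _ _)) (hmle _ _)
    have h2 := ennreal_two_mul_mul_rpow_add_le hmm hm't hxK (by positivity) hε hε1 hCε
    set V := volume (dCube o (k + 1) z') with hV
    set m := essInf u (volume.restrict (dCube o k z)) with hm
    set m' := essInf u (volume.restrict (dCube o (k + 1) z')) with hm'
    rw [hint (k + 1) z'] at h1 ⊢
    rw [← hV] at h1 ⊢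
    have hVt : V ≠ ∞ := volume_dCube_ne_top o _ _
    have hxt : V⁻¹ * ∫⁻ x in dCube o (k + 1) z', u x ≠ ∞ :=
      ne_top_of_le_ne_top (ENNReal.mul_ne_top ENNReal.ofReal_ne_top
        (ne_top_of_le_ne_top hm't hmm)) hxK
    set x := V⁻¹ * ∫⁻ x in dCube o (k + 1) z', u x with hx
    have hCt : (C : ℝ≥0∞) ^ ε ≠ ∞ := ENNReal.rpow_ne_top_of_nonneg hε.le ENNReal.coe_ne_top
    have ht : C ^ ε * (m' ^ (1 + ε) * V) + C ^ ε * (2 * m' ^ ε * (x * V)) ≠ ∞ := by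
      have h3 : m' ^ (1 + ε) ≠ ∞ := ENNReal.rpow_ne_top_of_nonneg hε2.le hm't
      have h4 : m' ^ ε ≠ ∞ := ENNReal.rpow_ne_top_of_nonneg hε.le hm't
      finiteness
    -- The child's Bellman terms are finite, so they can be added to both sides in place of a
    -- subtraction.
    refine (ENNReal.add_le_add_iff_right ht).1 ?_
    calc (∫⁻ x in dCube o (k + 1) z', dExpect o u (k + 1 + N) x ^ (1 + ε)) +
          C ^ ε * (m ^ (1 + ε) * V) +
          (C ^ ε * (m' ^ (1 + ε) * V) + C ^ ε * (2 * m' ^ ε * (x * V)))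
        = ((∫⁻ x in dCube o (k + 1) z', dExpect o u (k + 1 + N) x ^ (1 + ε)) +
          C ^ ε * (m' ^ (1 + ε) * V)) + C ^ ε * V * (2 * x * m' ^ ε + m ^ (1 + ε)) := by ring
      _ ≤ C ^ ε * (2 * m' ^ ε * (x * V)) +
          C ^ ε * V * (2 * x * m ^ ε + m' ^ (1 + ε)) := by gcongr
      _ = _ := by ring

/-- The reverse Hölder inequality for an `A_1` weight. -/
theorem reverse_holder_of_le_essInf {o : Fin n → ℝ} {u : (Fin n → ℝ) → ℝ≥0∞} (hu : Measurable u)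
    {C : ℝ≥0} (hfin : ∀ k z, ∫⁻ x in dCube o k z, u x ≠ ∞)
    (hC : ∀ k z, (volume (dCube o k z))⁻¹ * ∫⁻ x in dCube o k z, u x ≤
      C * essInf u (volume.restrict (dCube o k z))) {ε : ℝ} (hε : 0 < ε) (hε1 : ε ≤ 1)
    (hCε : 2 * (2 ^ n * C * ε) ≤ 1) (k : ℤ) (z : Fin n → ℤ) :
    (volume (dCube o k z))⁻¹ * ∫⁻ x in dCube o k z, u x ^ (1 + ε) ≤
      2 * C ^ ε * ((volume (dCube o k z))⁻¹ * ∫⁻ x in dCube o k z, u x) ^ (1 + ε) := by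
  have hε2 : 0 < 1 + ε := by linarith
  have hmle : essInf u (volume.restrict (dCube o k z)) ≤
      (volume (dCube o k z))⁻¹ * ∫⁻ x in dCube o k z, u x := by
    rw [← ENNReal.div_eq_inv_mul, ENNReal.le_div_iff_mul_le
      (Or.inl (volume_dCube_ne_zero o k z)) (Or.inl (volume_dCube_ne_top o k z)),
      ← setLIntegral_const]
    exact lintegral_mono_ae ae_essInf_le
  have h1 : ∫⁻ x in dCube o k z, u x ^ (1 + ε) ≤
      C ^ ε * (2 * essInf u (volume.restrict (dCube o k z)) ^ ε * ∫⁻ x in dCube o k z, u x) := by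
    -- Lebesgue differentiation and Fatou remove the dyadic truncation, since the bound does not
    -- depend on `N`.
    calc ∫⁻ x in dCube o k z, u x ^ (1 + ε)
        = ∫⁻ x in dCube o k z, liminf (fun N : ℕ => dExpect o u (k + N) x ^ (1 + ε)) atTop := by
          refine setLIntegral_congr_fun_ae (measurableSet_dCube o k z) ?_
          filter_upwards [ae_tendsto_dExpect o k z hu (hfin k z)] with x hx hxQ
          exact (((ENNReal.continuous_rpow_const (y := 1 + ε)).tendsto _).comp
            (hx hxQ)).liminf_eq.symm
      _ ≤ liminf (fun N : ℕ => ∫⁻ x in dCube o k z, dExpect o u (k + N) x ^ (1 + ε)) atTop :=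
          lintegral_liminf_le fun N => (measurable_dExpect o u _).pow_const _
      _ ≤ _ := by
          refine liminf_le_of_frequently_le' (Frequently.of_forall fun N => ?_)
          exact le_self_add.trans (lintegral_dExpect_rpow_add_le hfin hC hε hε1 hCε N k z)
  calc _ ≤ (volume (dCube o k z))⁻¹ * (C ^ ε * (2 * ((volume (dCube o k z))⁻¹ *
        ∫⁻ x in dCube o k z, u x) ^ ε * ∫⁻ x in dCube o k z, u x)) := by
        gcongr
        refine h1.trans ?_
        gcongr
    _ = _ := by
        rw [ENNReal.rpow_add_of_nonneg _ _ zero_le_one hε.le, ENNReal.rpow_one]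
        ring

end ReverseHolder

/-! ### Combining `A_1` and `A_q` on dyadic grids -/

section

/-- The relation between the exponents says that `s / p` and `1 / ((p-1)(q-1))` are conjugate.
Hölder with this pair leaves exactly the `(p-1)`-st power of the `A_q` product. -/
theorem lintegral_rpow_mul_rpow_le {X : Type*} [MeasurableSpace X] (μ : Measure X)
    {u r : X → ℝ≥0∞} (hu : AEMeasurable u μ) (hr : AEMeasurable r μ) {p q s : ℝ} (hp : 1 < p)
    (hq : 1 < q) (hs : 0 < s) (hpqs : p / s + (p - 1) * (q - 1) = 1) {K L : ℝ≥0∞}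
    (hK : ∫⁻ x, u x ^ s ∂μ ≤ K * (∫⁻ x, u x ∂μ) ^ s)
    (hL : (∫⁻ x, r x ∂μ) * (∫⁻ x, r x ^ (-1 / (q - 1)) ∂μ) ^ (q - 1) ≤ L) :
    (∫⁻ x, u x ^ p * r x ^ (1 - p) ∂μ) * (∫⁻ x, r x ∂μ) ^ (p - 1) ≤
      K ^ (p / s) * L ^ (p - 1) * (∫⁻ x, u x ∂μ) ^ p := by
  have hp0 : 0 < p := by linarith
  have hp1 : 0 < p - 1 := by linarith
  have hq1 : 0 < q - 1 := by linarith
  have hps : 0 < p / s := by positivity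
  have hpq : 0 < (p - 1) * (q - 1) := by positivity
  have hconj : (s / p).HolderConjugate (1 / ((p - 1) * (q - 1))) := by
    rw [Real.holderConjugate_iff]
    constructor
    · rw [lt_div_iff₀ hp0, one_mul, ← div_lt_one hs]; linarith
    · rw [inv_div, one_div, inv_inv]; exact hpqs
  have h1 := ENNReal.lintegral_mul_le_Lp_mul_Lq μ hconj (hu.pow_const p) (hr.pow_const (1 - p))
  have e1 : p * (s / p) = s := by field_simp
  have e2 : (1 - p) * (1 / ((p - 1) * (q - 1))) = -1 / (q - 1) := by field_simp; ring
  simp only [← ENNReal.rpow_mul, Pi.mul_apply, e1, e2, one_div_div, div_one] at h1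
  calc (∫⁻ x, u x ^ p * r x ^ (1 - p) ∂μ) * (∫⁻ x, r x ∂μ) ^ (p - 1)
      ≤ (∫⁻ x, u x ^ s ∂μ) ^ (p / s) * (∫⁻ x, r x ^ (-1 / (q - 1)) ∂μ) ^ ((p - 1) * (q - 1)) *
        (∫⁻ x, r x ∂μ) ^ (p - 1) := by gcongr
    _ = (∫⁻ x, u x ^ s ∂μ) ^ (p / s) * ((∫⁻ x, r x ∂μ) *
        (∫⁻ x, r x ^ (-1 / (q - 1)) ∂μ) ^ (q - 1)) ^ (p - 1) := by
        rw [ENNReal.mul_rpow_of_nonneg _ _ hp1.le, ← ENNReal.rpow_mul, mul_comm (q - 1)]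
        ring
    _ ≤ (K * (∫⁻ x, u x ∂μ) ^ s) ^ (p / s) * L ^ (p - 1) := by gcongr
    _ = _ := by
        rw [ENNReal.mul_rpow_of_nonneg _ _ hps.le, ← ENNReal.rpow_mul, mul_div_cancel₀ _ hs.ne']
        ring

variable {n : ℕ}

theorem exists_reverse_holder {u r : (Fin n → ℝ) → ℝ≥0∞} (hu : Measurable u) (hr : Measurable r)
    {C L : ℝ≥0} (hfin : ∀ a l, 0 < l → avg a l u ≠ ∞)
    (hC : ∀ a l, 0 < l → avg a l u ≤ C * essInf u (volume.restrict (cube a l))) {q : ℝ}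
    (hq : 1 < q)
    (hL : ∀ a l, 0 < l → avg a l r * avg a l (fun x => r x ^ (-1 / (q - 1))) ^ (q - 1) ≤ L) :
    ∃ p : ℝ, 1 < p ∧ ∃ K : ℝ≥0, ∀ (o : Fin n → ℝ) (k : ℤ) (z : Fin n → ℤ),
      (∫⁻ x in dCube o k z, u x ^ p * r x ^ (1 - p)) * (∫⁻ x in dCube o k z, r x) ^ (p - 1) ≤
        K * (∫⁻ x in dCube o k z, u x) ^ p := by
  -- The summand `1` keeps the denominator positive when `C = 0` and gives `ε ≤ 1`.
  set ε : ℝ := 1 / (2 * 2 ^ n * C + 1) with hε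
  have hC0 : (0 : ℝ) ≤ 2 * 2 ^ n * C := by positivity
  have hε0 : 0 < ε := by positivity
  have hε1 : ε ≤ 1 := by rw [hε, div_le_one (by positivity)]; linarith
  have hCε : 2 * (2 ^ n * C * ε) ≤ 1 := by
    rw [hε, mul_one_div, ← mul_div_assoc, div_le_one (by positivity)]; linarith
  set s : ℝ := 1 + ε with hs
  have hs1 : 1 < s := by linarith
  have hq1 : 0 < q - 1 := by linarith
  have hden : 0 < (q - 1) * s + 1 := by positivity
  -- The unique solution of `p / s + (p - 1)(q - 1) = 1`; it exceeds `1` precisely because `s > 1`.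
  set p : ℝ := q * s / ((q - 1) * s + 1) with hp
  have hp1 : 1 < p := by rw [hp, lt_div_iff₀ hden]; linarith
  have hp0 : 0 < p := by linarith
  have hpqs : p / s + (p - 1) * (q - 1) = 1 := by rw [hp]; field_simp; ring
  refine ⟨p, hp1, ((2 * C ^ ε : ℝ≥0)) ^ (p / s) * L ^ (p - 1), fun o k z => ?_⟩
  set V := volume (dCube o k z) with hV
  have hV0 : V ≠ 0 := volume_dCube_ne_zero o k z
  have hVt : V ≠ ∞ := volume_dCube_ne_top o k z
  have hl : (0 : ℝ) < (2 ^ k)⁻¹ := by positivity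
  have hfin' : ∀ k z, ∫⁻ x in dCube o k z, u x ≠ ∞ := fun k z h => by
    apply hfin (dCorner o k z) (2 ^ k)⁻¹ (by positivity)
    rw [avg_dCorner, h]
    exact ENNReal.mul_top (ENNReal.inv_ne_zero.2 (volume_dCube_ne_top o k z))
  have hC' : ∀ k z, (volume (dCube o k z))⁻¹ * ∫⁻ x in dCube o k z, u x ≤
      C * essInf u (volume.restrict (dCube o k z)) := fun k z => by
    rw [← avg_dCorner, restrict_dCube]
    exact hC _ _ (by positivity)
  have h1 := reverse_holder_of_le_essInf hu hfin' hC' hε0 hε1 hCε k z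
  have h2 := hL (dCorner o k z) _ hl
  rw [avg_dCorner, avg_dCorner] at h2
  -- The hypotheses are about averages, hence the normalized measure. Both sides of the conclusion
  -- are homogeneous of degree `p` in the measure, so the volume cancels.
  have h3 := lintegral_rpow_mul_rpow_le (V⁻¹ • volume.restrict (dCube o k z)) hu.aemeasurable
    hr.aemeasurable hp1 hq (by linarith : 0 < s) hpqs (K := 2 * C ^ ε) (L := L)
    (by simpa only [lintegral_smul_measure, smul_eq_mul] using h1)
    (by simpa only [lintegral_smul_measure, smul_eq_mul] using h2)
  simp only [lintegral_smul_measure, smul_eq_mul] at h3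
  rw [ENNReal.mul_rpow_of_nonneg _ _ hp0.le, ENNReal.mul_rpow_of_nonneg _ _ (by linarith)] at h3
  have hVp : V⁻¹ ^ p = V⁻¹ * V⁻¹ ^ (p - 1) := by
    nth_rewrite 2 [← ENNReal.rpow_one V⁻¹]
    rw [← ENNReal.rpow_add _ _ (ENNReal.inv_ne_zero.2 hVt) (ENNReal.inv_ne_top.2 hV0)]
    congr 1; ring
  have hVp0 : V⁻¹ ^ p ≠ 0 := by simp [hV0, hVt]
  have hVpt : V⁻¹ ^ p ≠ ∞ := by simp [hV0, hVt]
  rw [← ENNReal.mul_le_mul_iff_right hVp0 hVpt]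
  have hK : (((2 * C ^ ε : ℝ≥0) ^ (p / s) * L ^ (p - 1) : ℝ≥0) : ℝ≥0∞) =
      (2 * C ^ ε) ^ (p / s) * L ^ (p - 1) := by
    rw [ENNReal.coe_mul, ENNReal.coe_rpow_of_nonneg _ (by positivity),
      ENNReal.coe_rpow_of_nonneg _ (by linarith), ENNReal.coe_mul,
      ENNReal.coe_rpow_of_nonneg _ hε0.le]
    rfl
  rw [hK]
  calc _ = V⁻¹ * (∫⁻ x in dCube o k z, u x ^ p * r x ^ (1 - p)) *
        (V⁻¹ ^ (p - 1) * (∫⁻ x in dCube o k z, r x) ^ (p - 1)) := by rw [hVp]; ring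
    _ ≤ _ := h3
    _ = _ := by ring

/-- The mixed weak type inequality on a dyadic grid, for `u ∈ A_1` and `r ∈ A_q`. -/
theorem exists_mixed_weak_type_dCube {u r : (Fin n → ℝ) → ℝ≥0∞} (hu : Measurable u)
    (hr : Measurable r) (hu0 : ∀ x, u x ≠ 0) (hut : ∀ x, u x ≠ ∞) (hr0 : ∀ x, r x ≠ 0)
    (hrt : ∀ x, r x ≠ ∞) {C L : ℝ≥0} (hfin : ∀ a l, 0 < l → avg a l u ≠ ∞)
    (hC : ∀ a l, 0 < l → avg a l u ≤ C * essInf u (volume.restrict (cube a l))) {q : ℝ}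
    (hq : 1 < q)
    (hL : ∀ a l, 0 < l → avg a l r * avg a l (fun x => r x ^ (-1 / (q - 1))) ^ (q - 1) ≤ L) :
    ∃ K : ℝ≥0, ∀ (o : Fin n → ℝ) (G : (Fin n → ℝ) → ℝ≥0∞) (t : ℝ≥0∞), t ≠ 0 → t ≠ ∞ →
      t * volume.withDensity r {x | ∃ i : ℤ × (Fin n → ℤ), x ∈ dCube o i.1 i.2 ∧
        t < u x / r x * ((∫⁻ y in dCube o i.1 i.2, u y)⁻¹ * ∫⁻ y in dCube o i.1 i.2, G y)} ≤
      K * ∫⁻ x, G x := by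
  obtain ⟨p, hp, K, hK⟩ := exists_reverse_holder hu hr hfin hC hq hL
  have hpos : ∀ (f : (Fin n → ℝ) → ℝ≥0∞) (o : Fin n → ℝ) (k : ℤ) (z : Fin n → ℤ),
      Measurable f → (∀ x, f x ≠ 0) → ∫⁻ x in dCube o k z, f x ≠ 0 := by
    intro f o k z hf hf0 h
    rw [lintegral_eq_zero_iff hf] at h
    apply volume_dCube_ne_zero o k z
    rw [← Measure.restrict_eq_zero, ← ae_eq_bot, ← Filter.eventually_false_iff_eq_bot]
    filter_upwards [h] with x hx using hf0 x hx
  have hfin' : ∀ o k z, ∫⁻ x in dCube o k z, u x ≠ ∞ := fun o k z h => by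
    apply hfin (dCorner o k z) (2 ^ k)⁻¹ (by positivity)
    rw [avg_dCorner, h]
    exact ENNReal.mul_top (ENNReal.inv_ne_zero.2 (volume_dCube_ne_top o k z))
  -- The dual factor of the `A_q` product is nonzero, so an infinite integral of `r` would make the
  -- product infinite.
  have hrfin : ∀ o k z, ∫⁻ x in dCube o k z, r x ≠ ∞ := fun o k z h => by
    have h1 := hL (dCorner o k z) (2 ^ k)⁻¹ (by positivity)
    rw [avg_dCorner, avg_dCorner, h, ENNReal.mul_top (ENNReal.inv_ne_zero.2
      (volume_dCube_ne_top o k z)), ENNReal.top_mul, top_le_iff] at h1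
    · exact ENNReal.coe_ne_top h1
    · rw [Ne, ENNReal.rpow_eq_zero_iff_of_pos (by linarith), mul_eq_zero, not_or]
      exact ⟨ENNReal.inv_ne_zero.2 (volume_dCube_ne_top o k z),
        hpos _ o k z (by fun_prop) fun x => by simp [hr0 x, hrt x]⟩
  have hW : Measurable fun x => u x / r x := hu.div hr
  have hμ : ∀ o k z, volume.withDensity r (dCube o k z) = ∫⁻ x in dCube o k z, r x :=
    fun o k z => withDensity_apply _ (measurableSet_dCube o k z)
  have hcancel : ∀ a x, r x * (a / r x) = a := fun a x => ENNReal.mul_div_cancel (hr0 x) (hrt x)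
  have hint : ∀ (G : (Fin n → ℝ) → ℝ≥0∞) o k z,
      ∫⁻ x in dCube o k z, G x / r x ∂(volume.withDensity r) = ∫⁻ x in dCube o k z, G x := by
    intro G o k z
    rw [setLIntegral_withDensity_eq_setLIntegral_mul_non_measurable _ hr _
      (measurableSet_dCube o k z) (Eventually.of_forall fun x => (hrt x).lt_top)]
    simp only [Pi.mul_apply, hcancel]
  set K' : ℝ≥0∞ := 1 + (K : ℝ≥0∞) ^ (p / (p - 1)) * ENNReal.ofReal (p / (p - 1) *
    2 ^ (p / (p - 1)) / (p / (p - 1) - 1)) * ENNReal.ofReal (p / (p - 1)) with hK'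
  have hK't : K' ≠ ∞ := by
    have : (K : ℝ≥0∞) ^ (p / (p - 1)) ≠ ∞ := ENNReal.rpow_ne_top_of_nonneg
      (div_nonneg (by linarith) (by linarith)) ENNReal.coe_ne_top
    finiteness
  refine ⟨K'.toNNReal, fun o G t ht0 ht => ?_⟩
  rw [ENNReal.coe_toNNReal hK't]
  -- With `μ = r dx`, the functions `u / r` and `G / r` integrate to the Lebesgue integrals of `u`
  -- and `G`.
  have h1 := mixed_weak_type_of_reverse_holder (μ := volume.withDensity r) (nested_dCube o)
    (fun i => measurableSet_dCube o i.1 i.2) hW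
    (fun x => (ENNReal.div_pos (hu0 x) (hrt x)).ne') (fun x => ENNReal.div_ne_top (hut x) (hr0 x))
    hp (C := K) ENNReal.coe_ne_top
    (fun i => by rw [hμ]; exact hpos _ _ _ _ hr hr0) (fun i => by rw [hμ]; exact hrfin _ _ _)
    (fun i => by rw [hint]; exact hfin' _ _ _) (fun i => by
      rw [hint, hμ]
      refine le_trans (le_of_eq ?_) (hK o i.1 i.2)
      congr 1
      rw [setLIntegral_withDensity_eq_setLIntegral_mul _ hr (hW.pow_const p)
        (measurableSet_dCube _ _ _)]
      refine lintegral_congr fun x => ?_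
      rw [Pi.mul_apply, ENNReal.div_rpow_of_nonneg _ _ (by linarith), div_eq_mul_inv,
        mul_left_comm, ← ENNReal.rpow_neg]
      congr 1
      nth_rewrite 1 [← ENNReal.rpow_one (r x)]
      rw [← ENNReal.rpow_add _ _ (hr0 x) (hrt x), sub_eq_add_neg])
    (fun x => G x / r x) ht0 ht
  simp only [hint] at h1
  refine h1.trans (le_of_eq ?_)
  congr 1
  rw [lintegral_withDensity_eq_lintegral_mul_non_measurable _ hr
    (Eventually.of_forall fun x => (hrt x).lt_top)]
  simp only [Pi.mul_apply, hcancel]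

end

/-! ### Weak type Hölder inequality and consequences of the vector condition -/

section

/-- A weak type Hölder inequality: a product of `m` functions satisfying weak type `(1, 1)`
bounds, with finitely many variants of each function. -/
theorem mul_measure_pow_le_of_prod {X γ : Type*} [MeasurableSpace X] (μ : Measure X) [Fintype γ]
    {m : ℕ} (hm : 0 < m) {S : Set X} (E : γ → Fin m → ℝ≥0∞ → Set X) {K D t : ℝ≥0∞}
    {I : Fin m → ℝ≥0∞} (hI0 : ∀ i, I i ≠ 0) (hIt : ∀ i, I i ≠ ∞) (hD0 : D ≠ 0) (hDt : D ≠ ∞)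
    (ht0 : t ≠ 0) (ht : t ≠ ∞)
    (hE : ∀ c i τ, τ ≠ 0 → τ ≠ ∞ → τ * μ (E c i τ) ≤ K * I i)
    (hS : ∀ᵐ x ∂μ, x ∈ S → ∃ c, ∃ y : Fin m → ℝ≥0∞,
      (∀ i τ, τ < y i → x ∈ E c i τ) ∧ t < D * ∏ i, y i) :
    t * μ S ^ m ≤ (Fintype.card γ * m * K) ^ m * D * ∏ i, I i := by
  have hm' : (m : ℝ) ≠ 0 := by positivity
  have hroot : ∀ a : ℝ≥0∞, (a ^ (1 / (m : ℝ))) ^ m = a := fun a => by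
    rw [← ENNReal.rpow_natCast, ← ENNReal.rpow_mul, one_div_mul_cancel hm', ENNReal.rpow_one]
  have hrpos : ∀ a : ℝ≥0∞, a ≠ 0 → a ≠ ∞ → a ^ (1 / (m : ℝ)) ≠ 0 ∧ a ^ (1 / (m : ℝ)) ≠ ∞ :=
    fun a h0 h1 => ⟨by simp [h0, h1], by simp [h0, h1]⟩
  have hPI0 : ∏ i, I i ≠ 0 := Finset.prod_ne_zero_iff.2 fun i _ => hI0 i
  have hPIt : ∏ i, I i ≠ ∞ := ENNReal.prod_ne_top fun i _ => hIt i
  set P := (∏ i, I i) ^ (1 / (m : ℝ)) with hP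
  obtain ⟨hP0, hPt⟩ := hrpos _ hPI0 hPIt
  have hPm : P ^ m = ∏ i, I i := hroot _
  have htD0 : t / D ≠ 0 := (ENNReal.div_pos ht0 hDt).ne'
  have htDt : t / D ≠ ∞ := ENNReal.div_ne_top ht hD0
  set θ := (t / D) ^ (1 / (m : ℝ)) with hθ
  obtain ⟨hθ0, hθt⟩ := hrpos _ htD0 htDt
  have hθm : θ ^ m = t / D := hroot _
  rw [← hP] at hP0 hPt
  rw [← hθ] at hθ0 hθt
  -- Thresholds proportional to `I i`, with product `t / D`: every level set then gets the same
  -- bound `K * (P / θ)`, and a point of `S` must exceed at least one threshold.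
  set τ : Fin m → ℝ≥0∞ := fun i => θ * (I i / P) with hτ
  have hτ0 : ∀ i, τ i ≠ 0 := fun i => mul_ne_zero hθ0 (ENNReal.div_pos (hI0 i) hPt).ne'
  have hτt : ∀ i, τ i ≠ ∞ := fun i => ENNReal.mul_ne_top hθt (ENNReal.div_ne_top (hIt i) hP0)
  have hprod : ∏ i, τ i = t / D := by
    simp only [hτ, div_eq_mul_inv, Finset.prod_mul_distrib, Finset.prod_const, Finset.card_univ,
      Fintype.card_fin]
    rw [← ENNReal.inv_pow, hPm, ENNReal.mul_inv_cancel hPI0 hPIt, mul_one, hθm, div_eq_mul_inv]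
  have hsub : S ≤ᵐ[μ] ⋃ c, ⋃ i, E c i (τ i) := by
    filter_upwards [hS] with x hx hxS
    obtain ⟨c, y, hy, hty⟩ := hx hxS
    by_contra hne
    have hle : ∀ i, y i ≤ τ i := fun i => by
      by_contra! h
      exact hne (Set.mem_iUnion₂.2 ⟨c, i, hy i _ h⟩)
    refine absurd hty (not_lt.2 ?_)
    calc D * ∏ i, y i ≤ D * ∏ i, τ i := by gcongr with i; exact hle i
      _ = t := by rw [hprod, ENNReal.mul_div_cancel hD0 hDt]
  have hEτ : ∀ c i, μ (E c i (τ i)) ≤ K * (P / θ) := fun c i => by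
    have h1 := hE c i (τ i) (hτ0 i) (hτt i)
    rw [← ENNReal.mul_le_mul_iff_right (hτ0 i) (hτt i)]
    refine h1.trans (le_of_eq ?_)
    calc K * I i = K * I i * (θ * θ⁻¹) * (P⁻¹ * P) := by
          rw [ENNReal.mul_inv_cancel hθ0 hθt, ENNReal.inv_mul_cancel hP0 hPt, mul_one, mul_one]
      _ = _ := by simp only [hτ, div_eq_mul_inv]; ring
  have hSle : μ S ≤ Fintype.card γ * m * K * (P / θ) := by
    calc μ S ≤ μ (⋃ c, ⋃ i, E c i (τ i)) := measure_mono_ae hsub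
      _ ≤ ∑ c, μ (⋃ i, E c i (τ i)) := measure_iUnion_fintype_le _ _
      _ ≤ ∑ c : γ, ∑ i, μ (E c i (τ i)) :=
          Finset.sum_le_sum fun c _ => measure_iUnion_fintype_le _ _
      _ ≤ ∑ _c : γ, ∑ _i : Fin m, K * (P / θ) :=
          Finset.sum_le_sum fun c _ => Finset.sum_le_sum fun i _ => hEτ c i
      _ = _ := by simp; ring
  calc t * μ S ^ m ≤ t * (Fintype.card γ * m * K * (P / θ)) ^ m := by gcongr
    _ = (Fintype.card γ * m * K) ^ m * (∏ i, I i) * (t * (t / D)⁻¹) := by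
        rw [mul_pow, div_eq_mul_inv, mul_pow P, ← ENNReal.inv_pow, hPm, hθm]; ring
    _ = _ := by
        rw [ENNReal.inv_div (Or.inl hDt) (Or.inl hD0), ENNReal.mul_div_cancel ht0 ht]; ring

variable {n m : ℕ}

/-- The linear theory asks for positivity and finiteness at every point, so that division by weights
is exact; a change on a null set provides it. -/
theorem IsWeight.exists_measurable {w : (Fin n → ℝ) → ℝ≥0∞} (hw : IsWeight w) :
    ∃ w' : (Fin n → ℝ) → ℝ≥0∞, Measurable w' ∧ (∀ x, w' x ≠ 0) ∧ (∀ x, w' x ≠ ∞) ∧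
      w =ᵐ[volume] w' := by
  classical
  set g := hw.aemeasurable.mk w with hg
  have hgm : Measurable g := hw.aemeasurable.measurable_mk
  refine ⟨fun x => if g x = 0 ∨ g x = ∞ then 1 else g x, ?_, fun x => ?_, fun x => ?_, ?_⟩
  · exact Measurable.ite ((hgm (measurableSet_singleton 0)).union
      (hgm (measurableSet_singleton ∞))) measurable_const hgm
  · dsimp only; split_ifs with h
    · exact one_ne_zero
    · exact fun h' => h (Or.inl h')
  · dsimp only; split_ifs with h
    · exact ENNReal.one_ne_top
    · exact fun h' => h (Or.inr h')
  · filter_upwards [hw.aemeasurable.ae_eq_mk, hw.pos, hw.lt_top] with x h1 h2 h3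
    rw [← hg] at h1
    rw [h1] at h2 h3
    rw [if_neg (by simp [h2.ne', h3.ne]), h1]

theorem isWeight_nu {w : Fin m → (Fin n → ℝ) → ℝ≥0∞} (hw : ∀ i, IsWeight (w i)) :
    IsWeight (nu w) := by
  have hm : 0 ≤ 1 / (m : ℝ) := by positivity
  refine ⟨?_, ?_, ?_⟩
  · unfold nu
    exact Finset.aemeasurable_fun_prod _ fun i _ => (hw i).aemeasurable.pow_const _
  · filter_upwards [ae_all_iff.2 fun i => (hw i).pos, ae_all_iff.2 fun i => (hw i).lt_top]
      with x h1 h2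
    refine pos_iff_ne_zero.2 (Finset.prod_ne_zero_iff.2 fun i _ => ?_)
    simp [(h1 i).ne', (h2 i).ne]
  · filter_upwards [ae_all_iff.2 fun i => (hw i).lt_top] with x h2
    exact (ENNReal.prod_ne_top fun i _ =>
      ENNReal.rpow_ne_top_of_nonneg hm (h2 i).ne).lt_top

theorem volume_cube_ne_zero (a : Fin n → ℝ) {l : ℝ} (hl : 0 < l) : volume (cube a l) ≠ 0 := by
  rw [volume_cube]
  exact pow_ne_zero _ (by simpa using hl)

theorem volume_cube_ne_top (a : Fin n → ℝ) (l : ℝ) : volume (cube a l) ≠ ∞ := by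
  rw [volume_cube]
  exact ENNReal.pow_ne_top ENNReal.ofReal_ne_top

theorem IsWeight.avg_ne_zero {w : (Fin n → ℝ) → ℝ≥0∞} (hw : IsWeight w) (a : Fin n → ℝ) {l : ℝ}
    (hl : 0 < l) : avg a l w ≠ 0 := by
  refine mul_ne_zero (ENNReal.inv_ne_zero.2 (volume_cube_ne_top a l)) fun h => ?_
  rw [lintegral_eq_zero_iff' hw.aemeasurable.restrict] at h
  apply volume_cube_ne_zero a hl
  rw [← Measure.restrict_eq_zero, ← ae_eq_bot, ← Filter.eventually_false_iff_eq_bot]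
  filter_upwards [h, ae_restrict_of_ae hw.pos] with x hx hx' using hx'.ne' hx

theorem IsWeight.essInf_ne_top {w : (Fin n → ℝ) → ℝ≥0∞} (hw : IsWeight w) (a : Fin n → ℝ) {l : ℝ}
    (hl : 0 < l) : essInf w (volume.restrict (cube a l)) ≠ ∞ := by
  intro h
  apply volume_cube_ne_zero a hl
  rw [← Measure.restrict_eq_zero, ← ae_eq_bot, ← Filter.eventually_false_iff_eq_bot]
  filter_upwards [ae_essInf_le (f := w) (μ := volume.restrict (cube a l)),
    ae_restrict_of_ae hw.lt_top] with x hx hx'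
  rw [h, top_le_iff] at hx
  exact hx'.ne hx

section AOne

variable {w : Fin m → (Fin n → ℝ) → ℝ≥0∞} {C : ℝ≥0} {a : Fin n → ℝ} {l : ℝ}

theorem prod_inv_essInf_ne_zero (hw : ∀ i, IsWeight (w i)) (hl : 0 < l) :
    ∏ i, (essInf (w i) (volume.restrict (cube a l)))⁻¹ ≠ 0 :=
  Finset.prod_ne_zero_iff.2 fun i _ => ENNReal.inv_ne_zero.2 ((hw i).essInf_ne_top a hl)

theorem avg_nu_ne_top (hm : 0 < m) (hw : ∀ i, IsWeight (w i)) (hl : 0 < l)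
    (hC : avg a l (nu w) ^ m * ∏ i, (essInf (w i) (volume.restrict (cube a l)))⁻¹ ≤ C) : avg a l (nu w) ≠ ∞ := by
  intro h
  rw [h, ENNReal.top_pow hm.ne', ENNReal.top_mul (prod_inv_essInf_ne_zero hw hl), top_le_iff] at hC
  exact ENNReal.coe_ne_top hC

theorem essInf_ne_zero (hw : ∀ i, IsWeight (w i)) (hl : 0 < l)
    (hC : avg a l (nu w) ^ m * ∏ i, (essInf (w i) (volume.restrict (cube a l)))⁻¹ ≤ C) (i : Fin m) :
    essInf (w i) (volume.restrict (cube a l)) ≠ 0 := by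
  intro h
  have h1 : ∏ i, (essInf (w i) (volume.restrict (cube a l)))⁻¹ = ∞ := by
    rw [← Finset.mul_prod_erase _ _ (Finset.mem_univ i), h, ENNReal.inv_zero]
    exact ENNReal.top_mul (Finset.prod_ne_zero_iff.2 fun j _ =>
      ENNReal.inv_ne_zero.2 ((hw j).essInf_ne_top a hl))
  rw [h1, ENNReal.mul_top (pow_ne_zero _ ((isWeight_nu hw).avg_ne_zero a hl)), top_le_iff] at hC
  exact ENNReal.coe_ne_top hC

theorem avg_nu_pow_le (hw : ∀ i, IsWeight (w i)) (hl : 0 < l)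
    (hC : avg a l (nu w) ^ m * ∏ i, (essInf (w i) (volume.restrict (cube a l)))⁻¹ ≤ C) :
    avg a l (nu w) ^ m ≤ C * ∏ i, essInf (w i) (volume.restrict (cube a l)) := by
  have h : (∏ i, (essInf (w i) (volume.restrict (cube a l)))⁻¹) *
      ∏ i, essInf (w i) (volume.restrict (cube a l)) = 1 := by
    rw [← Finset.prod_mul_distrib]
    exact Finset.prod_eq_one fun i _ =>
      ENNReal.inv_mul_cancel (essInf_ne_zero hw hl hC i) ((hw i).essInf_ne_top a hl)
  calc avg a l (nu w) ^ m = avg a l (nu w) ^ m *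
        (∏ i, (essInf (w i) (volume.restrict (cube a l)))⁻¹) *
        ∏ i, essInf (w i) (volume.restrict (cube a l)) := by rw [mul_assoc, h, mul_one]
    _ ≤ _ := by gcongr

/-- The geometric mean of the essential infima of the `w i` is an almost everywhere lower bound for
`ν` on the cube, so `ν` is a scalar `A_1` weight. -/
theorem avg_nu_le_essInf (hm : 0 < m) (hw : ∀ i, IsWeight (w i)) (hl : 0 < l)
    (hC : avg a l (nu w) ^ m * ∏ i, (essInf (w i) (volume.restrict (cube a l)))⁻¹ ≤ C) :
    avg a l (nu w) ≤ (C ^ (1 / (m : ℝ)) : ℝ≥0) *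
      essInf (nu w) (volume.restrict (cube a l)) := by
  have hm0 : (0 : ℝ) < 1 / m := by positivity
  have h1 := ENNReal.rpow_le_rpow (avg_nu_pow_le hw hl hC) hm0.le
  rw [← ENNReal.rpow_natCast, ← ENNReal.rpow_mul, mul_one_div_cancel (by positivity),
    ENNReal.rpow_one, ENNReal.mul_rpow_of_nonneg _ _ hm0.le,
    ← ENNReal.coe_rpow_of_nonneg _ hm0.le, ← ENNReal.prod_rpow_of_nonneg hm0.le] at h1
  refine h1.trans ?_
  gcongr
  refine le_essInf_of_ae_le _ ?_
  filter_upwards [ae_all_iff.2 fun i => ae_essInf_le (f := w i)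
    (μ := volume.restrict (cube a l))] with x hx
  exact Finset.prod_le_prod' fun i _ => ENNReal.rpow_le_rpow (hx i) hm0.le

/-- Each `f i` is multiplied by the essential infimum of `w i`, which is at most `w i` inside the
integral; the vector condition compares the product of these infima with the `m`-th power of the
average of `ν`. -/
theorem prod_avg_le (hm : 0 < m) (hw : ∀ i, IsWeight (w i)) (hl : 0 < l)
    (hC : avg a l (nu w) ^ m * ∏ i, (essInf (w i) (volume.restrict (cube a l)))⁻¹ ≤ C)
    (f : Fin m → (Fin n → ℝ) → ℝ≥0∞) :
    ∏ i, avg a l (f i) ≤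
      C * ∏ i, ((∫⁻ x in cube a l, nu w x)⁻¹ * ∫⁻ x in cube a l, f i x * w i x) := by
  have hV0 := volume_cube_ne_zero a hl
  have hVt := volume_cube_ne_top a l
  have hA0 : avg a l (nu w) ≠ 0 := (isWeight_nu hw).avg_ne_zero a hl
  have hAt : avg a l (nu w) ≠ ∞ := avg_nu_ne_top hm hw hl hC
  have h1 : ∀ i, essInf (w i) (volume.restrict (cube a l)) * avg a l (f i) ≤
      avg a l (fun x => f i x * w i x) := fun i => by
    rw [avg, avg, mul_left_comm]
    gcongr
    rw [← lintegral_const_mul' _ _ ((hw i).essInf_ne_top a hl)]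
    refine lintegral_mono_ae ?_
    filter_upwards [ae_essInf_le (f := w i) (μ := volume.restrict (cube a l))] with x hx
    rw [mul_comm]
    gcongr
  have h2 : ∀ i, (∫⁻ x in cube a l, nu w x)⁻¹ * ∫⁻ x in cube a l, f i x * w i x =
      (avg a l (nu w))⁻¹ * avg a l (fun x => f i x * w i x) := fun i => by
    rw [avg, avg, ENNReal.mul_inv (Or.inl (ENNReal.inv_ne_zero.2 hVt))
      (Or.inl (ENNReal.inv_ne_top.2 hV0)), inv_inv, mul_mul_mul_comm,
      ENNReal.mul_inv_cancel hV0 hVt, one_mul]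
  simp_rw [h2]
  rw [Finset.prod_mul_distrib, Finset.prod_const, Finset.card_univ, Fintype.card_fin,
    ← ENNReal.inv_pow]
  set A := avg a l (nu w) ^ m with hA
  have hA0' : A ≠ 0 := pow_ne_zero _ hA0
  have hAt' : A ≠ ∞ := ENNReal.pow_ne_top hAt
  calc ∏ i, avg a l (f i) = A⁻¹ * (A * ∏ i, avg a l (f i)) := by
        rw [← mul_assoc, ENNReal.inv_mul_cancel hA0' hAt', one_mul]
    _ ≤ A⁻¹ * (C * (∏ i, essInf (w i) (volume.restrict (cube a l))) * ∏ i, avg a l (f i)) := by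
        gcongr
        exact avg_nu_pow_le hw hl hC
    _ = A⁻¹ * (C * ∏ i, (essInf (w i) (volume.restrict (cube a l)) * avg a l (f i))) := by
        rw [Finset.prod_mul_distrib]; ring
    _ ≤ A⁻¹ * (C * ∏ i, avg a l (fun x => f i x * w i x)) := by
        gcongr with i
        exact h1 i
    _ = _ := by ring

end AOne

end

/-! ### Reduction of the multilinear maximal function to the grids -/

section

variable {n m : ℕ}

theorem avg_congr_ae {g h : (Fin n → ℝ) → ℝ≥0∞} (hgh : g =ᵐ[volume] h) (a : Fin n → ℝ) (l : ℝ) :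
    avg a l g = avg a l h := by
  rw [avg, avg, lintegral_congr_ae (ae_restrict_of_ae hgh)]

theorem multiMaximal_eq_zero {f : Fin m → (Fin n → ℝ) → ℂ} {i : Fin m} (hi : f i =ᵐ[volume] 0)
    (x : Fin n → ℝ) : multiMaximal f x = 0 := by
  have h0 : (fun y => ‖f i y‖ₑ) =ᵐ[volume] 0 := by
    filter_upwards [hi] with y hy using by simp [hy]
  simp only [multiMaximal, ENNReal.iSup_eq_zero]
  intro a l _ _
  refine Finset.prod_eq_zero (Finset.mem_univ i) ?_
  rw [avg_congr_ae h0]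
  simp [avg]

/-- The points where the maximal function restricted to cubes of side length at most `2 ^ K / 6`
is large. -/
def levelSet (f : Fin m → (Fin n → ℝ) → ℂ) (v : (Fin n → ℝ) → ℝ≥0∞) (t : ℝ≥0∞) (K : ℕ) :
    Set (Fin n → ℝ) :=
  {x | ∃ (a : Fin n → ℝ) (l : ℝ), 0 < l ∧ 6 * l ≤ 2 ^ K ∧ x ∈ cube a l ∧
    t < (∏ i, avg a l fun y => ‖f i y‖ₑ) / v x}

theorem monotone_levelSet (f : Fin m → (Fin n → ℝ) → ℂ) (v : (Fin n → ℝ) → ℝ≥0∞) (t : ℝ≥0∞) :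
    Monotone (levelSet f v t) := by
  rintro K K' hK x ⟨a, l, hl, hlK, hx, hlt⟩
  exact ⟨a, l, hl, hlK.trans (pow_le_pow_right₀ one_le_two hK), hx, hlt⟩

theorem setOf_lt_multiMaximal_div (f : Fin m → (Fin n → ℝ) → ℂ) (v : (Fin n → ℝ) → ℝ≥0∞)
    (t : ℝ≥0∞) : {x | t < multiMaximal f x / v x} = ⋃ K, levelSet f v t K := by
  ext x
  simp only [multiMaximal, ENNReal.iSup_div, lt_iSup_iff, Set.mem_iUnion, levelSet,
    Set.mem_ofPred_eq]
  constructor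
  · rintro ⟨a, l, hl, hx, h⟩
    obtain ⟨K, hK⟩ := pow_unbounded_of_one_lt (6 * l) one_lt_two
    exact ⟨K, a, l, hl, hK.le, hx, h⟩
  · rintro ⟨K, a, l, hl, -, hx, h⟩
    exact ⟨a, l, hl, hx, h⟩

/-- One dyadic cube serves all `m` factors, each losing `6^n`. Sharing the cube is what allows the
vector condition to be applied. -/
theorem exists_prod_avg_div_le (hm : 0 < m) {w : Fin m → (Fin n → ℝ) → ℝ≥0∞}
    (hw : ∀ i, IsWeight (w i)) {C : ℝ≥0}
    (hC : ∀ (a : Fin n → ℝ) (l : ℝ), 0 < l → avg a l (nu w) ^ m *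
      ∏ i, (essInf (w i) (volume.restrict (cube a l)))⁻¹ ≤ C)
    (f : Fin m → (Fin n → ℝ) → ℝ≥0∞) {K : ℕ} {a : Fin n → ℝ} {l : ℝ} (hl : 0 < l)
    (hlK : 6 * l ≤ 2 ^ K) :
    ∃ c k z, cube a l ⊆ dCube (gridOrigin K c) k z ∧ ∏ i, avg a l (f i) ≤
      6 ^ (n * m) * C * ∏ i, ((∫⁻ x in dCube (gridOrigin K c) k z, nu w x)⁻¹ *
        ∫⁻ x in dCube (gridOrigin K c) k z, f i x * w i x) := by
  obtain ⟨c, k, z, hsub, hkl⟩ := exists_cube_subset_dCube a hl hlK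
  refine ⟨c, k, z, hsub, ?_⟩
  have hk : (0 : ℝ) < (2 ^ k)⁻¹ := by positivity
  have h1 := prod_avg_le hm hw hk (hC (dCorner (gridOrigin K c) k z) _ hk) f
  rw [← restrict_dCube] at h1
  calc ∏ i, avg a l (f i)
      ≤ ∏ i, 6 ^ n * avg (dCorner (gridOrigin K c) k z) (2 ^ k)⁻¹ (f i) :=
        Finset.prod_le_prod' fun i _ => avg_le_of_cube_subset_dCube hl hsub hkl (f i)
    _ = 6 ^ (n * m) * ∏ i, avg (dCorner (gridOrigin K c) k z) (2 ^ k)⁻¹ (f i) := by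
        rw [Finset.prod_mul_distrib, Finset.prod_const, Finset.card_univ, Fintype.card_fin,
          ← pow_mul]
    _ ≤ _ := by
        rw [mul_assoc]
        exact mul_le_mul' le_rfl h1

/-- The grids depend on `K`, but their number and the weak type constant on each do not, so the
bound is uniform in `K`. -/
theorem exists_mul_measure_levelSet_le (hm : 0 < m) {w : Fin m → (Fin n → ℝ) → ℝ≥0∞}
    {v : (Fin n → ℝ) → ℝ≥0∞} (hw : MemAOneVec w) (hv : IsWeight v)
    (hnuv : MemAInfty fun x => nu w x * v x ^ (1 / (m : ℝ))) :
    ∃ B : ℝ≥0, ∀ f : Fin m → (Fin n → ℝ) → ℂ,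
      (∀ i, ∫⁻ x, ‖f i x‖ₑ * w i x ≠ 0) → (∀ i, ∫⁻ x, ‖f i x‖ₑ * w i x ≠ ∞) →
      ∀ t : ℝ≥0∞, t ≠ 0 → t ≠ ∞ → ∀ K : ℕ,
        t * volume.withDensity (fun x => nu w x * v x ^ (1 / (m : ℝ))) (levelSet f v t K) ^ m ≤
          B * ∏ i, ∫⁻ x, ‖f i x‖ₑ * w i x := by
  obtain ⟨hwW, C, hC⟩ := hw
  obtain ⟨q, hq, hrW, L, hL⟩ := hnuv
  obtain ⟨u, hum, hu0, hut, hu⟩ := (isWeight_nu hwW).exists_measurable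
  obtain ⟨r, hrm, hr0, hrt, hr⟩ := hrW.exists_measurable
  have hrpow : (fun x => (nu w x * v x ^ (1 / (m : ℝ))) ^ (-1 / (q - 1))) =ᵐ[volume]
      fun x => r x ^ (-1 / (q - 1)) := by
    filter_upwards [hr] with x hx
    rw [← hx]
  obtain ⟨A, hA⟩ := exists_mixed_weak_type_dCube hum hrm hu0 hut hr0 hrt
    (C := C ^ (1 / (m : ℝ))) (L := L) (q := q)
    (fun a l hl => by
      rw [← avg_congr_ae hu]
      exact avg_nu_ne_top hm hwW hl (hC a l hl))
    (fun a l hl => by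
      rw [← avg_congr_ae hu, ← essInf_congr_ae (ae_restrict_of_ae hu)]
      exact avg_nu_le_essInf hm hwW hl (hC a l hl)) hq
    (fun a l hl => by
      rw [← avg_congr_ae hr, ← avg_congr_ae hrpow]
      exact hL a l hl)
  rw [withDensity_congr_ae hr]
  -- `C + 1` in place of `C` keeps `D` nonzero, as the choice of thresholds requires.
  set D : ℝ≥0 := 6 ^ (n * m) * (C + 1) with hD
  refine ⟨(Fintype.card (Fin n → Bool) * m * A) ^ m * D, fun f hf0 hft t ht0 ht K => ?_⟩
  have hDpos : D ≠ 0 := by positivity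
  have key := mul_measure_pow_le_of_prod (volume.withDensity r) hm (S := levelSet f v t K)
    (γ := Fin n → Bool) (K := A) (D := D) (t := t) (I := fun i => ∫⁻ x, ‖f i x‖ₑ * w i x)
    (fun c i τ => {x | ∃ j : ℤ × (Fin n → ℤ), x ∈ dCube (gridOrigin K c) j.1 j.2 ∧
      τ < u x / r x * ((∫⁻ y in dCube (gridOrigin K c) j.1 j.2, u y)⁻¹ *
        ∫⁻ y in dCube (gridOrigin K c) j.1 j.2, ‖f i y‖ₑ * w i y)})
    hf0 hft (by exact_mod_cast hDpos) ENNReal.coe_ne_top ht0 ht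
    (fun c i τ hτ0 hτt => hA (gridOrigin K c) (fun y => ‖f i y‖ₑ * w i y) τ hτ0 hτt) ?_
  · refine key.trans (le_of_eq ?_)
    push_cast
    ring
  refine (withDensity_absolutelyContinuous _ _).ae_le ?_
  filter_upwards [hu, hr, hv.pos, hv.lt_top] with x hux hrx hv0 hvt
  rintro ⟨a, l, hl, hlK, hx, hlt⟩
  obtain ⟨c, k, z, hsub, hle⟩ :=
    exists_prod_avg_div_le hm hwW hC (fun i y => ‖f i y‖ₑ) hl hlK
  refine ⟨c, fun i => u x / r x * ((∫⁻ y in dCube (gridOrigin K c) k z, u y)⁻¹ *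
    ∫⁻ y in dCube (gridOrigin K c) k z, ‖f i y‖ₑ * w i y),
    fun i τ hτ => ⟨(k, z), hsub hx, hτ⟩, hlt.trans_le ?_⟩
  -- The `m` factors `u / r`, one for each linear operator, multiply to the `1 / v` of the
  -- statement.
  have hur : (u x / r x) ^ m = (v x)⁻¹ := by
    have h1 : u x / r x = (v x)⁻¹ ^ (1 / (m : ℝ)) := by
      rw [← hrx, hux, ENNReal.inv_rpow, ENNReal.div_eq_inv_mul,
        ENNReal.mul_inv (Or.inl (hu0 x)) (Or.inl (hut x)), mul_right_comm,
        ENNReal.inv_mul_cancel (hu0 x) (hut x), one_mul]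
    rw [h1, ← ENNReal.rpow_natCast, ← ENNReal.rpow_mul, one_div_mul_cancel (by positivity),
      ENNReal.rpow_one]
  rw [Finset.prod_mul_distrib, Finset.prod_const, Finset.card_univ, Fintype.card_fin, hur,
    ← lintegral_congr_ae (ae_restrict_of_ae hu), div_eq_mul_inv]
  calc _ ≤ 6 ^ (n * m) * C * (∏ i, ((∫⁻ x in dCube (gridOrigin K c) k z, nu w x)⁻¹ *
        ∫⁻ x in dCube (gridOrigin K c) k z, ‖f i x‖ₑ * w i x)) * (v x)⁻¹ :=
        mul_le_mul' hle le_rfl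
    _ = 6 ^ (n * m) * C * ((v x)⁻¹ * ∏ i, ((∫⁻ x in dCube (gridOrigin K c) k z, nu w x)⁻¹ *
        ∫⁻ x in dCube (gridOrigin K c) k z, ‖f i x‖ₑ * w i x)) := by ring
    _ ≤ _ := by
        refine mul_le_mul' ?_ le_rfl
        rw [hD]
        push_cast
        gcongr
        exact le_self_add

end

end MixedWeak

end

theorem mainTheorem2 {n m : ℕ} (hn : 0 < n) (hm : 0 < m)
    (w : Fin m → (Fin n → ℝ) → ℝ≥0∞) (v : (Fin n → ℝ) → ℝ≥0∞)
    (hw : MixedWeak.MemAOneVec w) (hv : MixedWeak.IsWeight v)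
    (hnuv : MixedWeak.MemAInfty (fun x => MixedWeak.nu w x * v x ^ (1 / (m : ℝ)))) :
    ∃ C : ℝ≥0, ∀ f : Fin m → (Fin n → ℝ) → ℂ, (∀ i, AEMeasurable (f i) volume) →
      MixedWeak.weakNorm (1 / (m : ℝ))
          (volume.withDensity (fun x => MixedWeak.nu w x * v x ^ (1 / (m : ℝ))))
          (fun x => MixedWeak.multiMaximal f x / v x) ≤
        C * ∏ i, ∫⁻ x, ‖f i x‖ₑ * w i x := by
  obtain ⟨B, hB⟩ := MixedWeak.exists_mul_measure_levelSet_le hm hw hv hnuv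
  -- A nonzero constant is needed so that the right side is infinite when some norm is infinite and
  -- none is zero.
  refine ⟨B + 1, fun f hf => iSup₂_le fun t ht => ?_⟩
  have ht0 : (t : ℝ≥0∞) ≠ 0 := by exact_mod_cast ht.ne'
  rw [one_div_one_div, ENNReal.rpow_natCast]
  by_cases hz : ∃ i, ∫⁻ x, ‖f i x‖ₑ * w i x = 0
  · obtain ⟨i, hi⟩ := hz
    have hmeas : AEMeasurable (fun x => ‖f i x‖ₑ * w i x) volume :=
      (hf i).enorm.mul (hw.1 i).aemeasurable
    rw [lintegral_eq_zero_iff' hmeas] at hi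
    have hfi : f i =ᵐ[volume] 0 := by
      filter_upwards [hi, (hw.1 i).pos] with x hx hx'
      simpa [hx'.ne'] using hx
    have hempty : {x | (t : ℝ≥0∞) < MixedWeak.multiMaximal f x / v x} = ∅ := by
      ext x
      simp [MixedWeak.multiMaximal_eq_zero hfi x]
    rw [hempty, measure_empty, zero_pow hm.ne', mul_zero]
    exact zero_le
  push Not at hz
  by_cases hinf : ∃ i, ∫⁻ x, ‖f i x‖ₑ * w i x = ∞
  · obtain ⟨i, hi⟩ := hinf
    have htop : ∏ i, ∫⁻ x, ‖f i x‖ₑ * w i x = ∞ := by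
      rw [← Finset.mul_prod_erase _ _ (Finset.mem_univ i), hi]
      exact ENNReal.top_mul (Finset.prod_ne_zero_iff.2 fun j _ => hz j)
    rw [htop, ENNReal.mul_top (by simp)]
    exact le_top
  push Not at hinf
  rw [MixedWeak.setOf_lt_multiMaximal_div]
  -- Continuity from below along increasing sets removes the restriction on side lengths.
  have hlim := tendsto_measure_iUnion_atTop
    (μ := volume.withDensity fun x => MixedWeak.nu w x * v x ^ (1 / (m : ℝ)))
    (MixedWeak.monotone_levelSet f v t)
  refine le_of_tendsto' (ENNReal.Tendsto.const_mul (((ENNReal.continuous_pow m).tendsto _).comp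
    hlim) (Or.inr ENNReal.coe_ne_top)) fun K => ?_
  refine (hB f hz hinf t ht0 ENNReal.coe_ne_top K).trans ?_
  gcongr
  simp
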